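/- Let $\xi_1,\dots,\xi_m:\mathbb C^n\to\mathbb C$ be non-constant affine functions, let $M=\mathbb C^n\setminus\bigcup_i\{\xi_i=0\}$, and let $\alpha\in\mathbb R^m$ have positive components and rank one (the $\mathbb Q$-vector space spanned by $\alpha_1,\dots,\alpha_m$ in $\mathbb R$ has dimension $1$). Put $$f_\alpha(z)=\prod_i|\xi_i(z)|^{\alpha_i},\qquad \omega_\alpha=\sum_i\alpha_i\frac{d\xi_i}{\xi_i},\qquad V=\{z\in M : f_\alpha(z)=\varepsilon\}.$$ Let $\iota_\alpha$ be the vector field on $M$ dual to $\operatorname{Im}\omega_\alpha$ for the Euclidean scalar product on $\mathbb C^n=\mathbb R^{2n}$, and let $y_\alpha=\iota_\alpha/\|\iota_\alpha\|^2$. Then there is $\varepsilon_0>0$ such that for every $\varepsilon\in\,]0,\varepsilon_0[$ the following holds. The set $V$ is a non-empty embedded $C^\infty$ submanifold of $\mathbb C^n$ of dimension $2n-1$, the field $\iota_\alpha$ has no zero on $V$, and the restriction of $y_\alpha$ to $V$ has a complete smooth flow $\gamma:V\times\mathbb R\to V$. For some $a>0$ there is a smooth map $g:V\to\mathbb R/a\mathbb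 R\approx S^1$ whose differential is the restriction of $\operatorname{Im}\omega_\alpha$ to $V$. For every $a>0$ and every such map $g:V\to\mathbb R/a\mathbb R$: 1. $g$ is a locally trivial smooth (surjective) fibration, whose fibres are embedded submanifolds of dimension $2n-2$; 2. $g(\gamma(x,t))=g(x)+t \bmod a$ for all $x\in V$, $t\in\mathbb R$; 3. for every $b\in\mathbb R$ with image $\bar b\in\mathbb R/a\mathbb R$, and with $c$ the image of $b+a/2$, the map $(x,t)\mapsto\gamma(x,t)$ is a diffeomorphism $$g^{-1}(\bar b)\times\,]-a/2,a/2[\ \longrightarrow\ g^{-1}\big((\mathbb R/a\mathbb R)\setminus\{c\}\big).$$ -/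

import Mathlib

open Set Topology
open scoped ContDiff

noncomputable section

namespace Arrangement

/-! ### Smooth subsets of a real normed space -/

section Smooth

variable {E F : Type*} [NormedAddCommGroup E] [NormedSpace ℝ E]
  [NormedAddCommGroup F] [NormedSpace ℝ F]

/-- `S` is an embedded `C^∞` submanifold of dimension `d` of `E`: around each of its points there
is a smooth chart of `E` onto an open subset of `ℝ^d × ℝ^k` in which `S` is the slice
`ℝ^d × {0}`. -/
def IsEmbeddedSubmanifold (d : ℕ) (S : Set E) : Prop :=
  ∀ x ∈ S, ∃ (k : ℕ)
    (φ : OpenPartialHomeomorph E (EuclideanSpace ℝ (Fin d) × EuclideanSpace ℝ (Fin k))),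
    x ∈ φ.source ∧ ContDiffOn ℝ ∞ φ φ.source ∧ ContDiffOn ℝ ∞ φ.symm φ.target ∧
      ∀ y ∈ φ.source, y ∈ S ↔ (φ y).2 = 0

/-- `φ` restricts to a `C^∞` diffeomorphism of the subset `A` onto the subset `B`. (On an embedded
submanifold, `ContDiffOn` is the usual smoothness of a map: it amounts to the existence of local
smooth extensions, or to smoothness in charts.) -/
def IsDiffeoOn (φ : E → F) (A : Set E) (B : Set F) : Prop :=
  BijOn φ A B ∧ ContDiffOn ℝ ∞ φ A ∧ ∃ ψ : F → E, ContDiffOn ℝ ∞ ψ B ∧ InvOn ψ φ A B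

variable {a : ℝ} {S : Set E}

/-- A map from `S` to the circle `ℝ / aℝ` is smooth: locally on `S` it is the reduction modulo `a`
of a smooth real function. -/
def IsSmoothToCircle (g : S → AddCircle a) : Prop :=
  ∀ x ∈ S, ∃ (W : Set E) (h : E → ℝ), IsOpen W ∧ x ∈ W ∧ ContDiffOn ℝ ∞ h (S ∩ W) ∧
    ∀ y (hy : y ∈ S), y ∈ W → (h y : AddCircle a) = g ⟨y, hy⟩

/-- The map `g : S → ℝ / aℝ` is smooth and its differential is the restriction to `S` of the
`1`-form `η`: locally on `S`, `g` is the reduction modulo `a` of a smooth real function `h` with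
`dh = η` along `S`. (The derivative within `S` only sees the directions tangent to `S`.) -/
def HasDifferential (g : S → AddCircle a) (η : E → E →L[ℝ] ℝ) : Prop :=
  ∀ x ∈ S, ∃ (W : Set E) (h : E → ℝ), IsOpen W ∧ x ∈ W ∧ ContDiffOn ℝ ∞ h (S ∩ W) ∧
    ∀ y (hy : y ∈ S), y ∈ W →
      (h y : AddCircle a) = g ⟨y, hy⟩ ∧ HasFDerivWithinAt h (η y) S y

/-- The part of `S` lying over the subset `U` of the circle, as a subset of `E`. -/
def preimageIn (g : S → AddCircle a) (U : Set (AddCircle a)) : Set E :=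
  Subtype.val '' (g ⁻¹' U)

/-- `g : S → ℝ / aℝ` is a locally trivial smooth fibration with fibres of dimension `d`: it is
smooth and surjective, its fibres are embedded submanifolds of dimension `d`, and each point
`b mod a` of the circle has an open arc neighbourhood `U`, the diffeomorphic image of an
interval `I = ]b - r, b + r[` of length at most `a`, over which there is a diffeomorphism
`Ψ : g⁻¹(b mod a) × I → g⁻¹(U)` compatible with the projections to the arc. -/
def IsLocallyTrivialSmoothFibration (d : ℕ) (g : S → AddCircle a) : Prop :=
  IsSmoothToCircle g ∧ Function.Surjective g ∧
  (∀ c : AddCircle a, IsEmbeddedSubmanifold d (preimageIn g {c})) ∧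
  ∀ b : ℝ, ∃ r : ℝ, 0 < r ∧ 2 * r ≤ a ∧ ∃ Ψ : E × ℝ → E,
    IsDiffeoOn Ψ (preimageIn g {(b : AddCircle a)} ×ˢ Ioo (b - r) (b + r))
      (preimageIn g ((fun t : ℝ => (t : AddCircle a)) '' Ioo (b - r) (b + r))) ∧
    ∀ x ∈ preimageIn g {(b : AddCircle a)}, ∀ t ∈ Ioo (b - r) (b + r),
      ∃ h : Ψ (x, t) ∈ S, g ⟨Ψ (x, t), h⟩ = (t : AddCircle a)

/-- `Φ` is a complete smooth flow of the vector field `Y` on `S`: for each `x ∈ S` the curve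
`t ↦ Φ x t` stays in `S`, is defined for all times, starts at `x` and is an integral curve of
`Y`; and `Φ` is smooth on `S × ℝ`. -/
structure IsCompleteFlow (Y : E → E) (S : Set E) (Φ : E → ℝ → E) : Prop where
  mem : ∀ x ∈ S, ∀ t : ℝ, Φ x t ∈ S
  zero : ∀ x ∈ S, Φ x 0 = x
  deriv : ∀ x ∈ S, ∀ t : ℝ, HasDerivAt (Φ x) (Y (Φ x t)) t
  smooth : ContDiffOn ℝ ∞ (fun p : E × ℝ => Φ p.1 p.2) (S ×ˢ univ)

end Smooth

/-! ### Hyperplane arrangements in `ℂ^n` -/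

section Arr

variable {n m : ℕ}

/-- The complement in `ℂ^n` of the union of the hyperplanes `ξ i = 0`. -/
def complement (ξ : Fin m → EuclideanSpace ℂ (Fin n) →ᵃ[ℂ] ℂ) : Set (EuclideanSpace ℂ (Fin n)) :=
  {z | ∀ i, ξ i z ≠ 0}

/-- The function `f_α = ∏ |ξ_i|^{α_i}`. -/
def absValue (ξ : Fin m → EuclideanSpace ℂ (Fin n) →ᵃ[ℂ] ℂ) (α : Fin m → ℝ)
    (z : EuclideanSpace ℂ (Fin n)) : ℝ :=
  ∏ i, ‖ξ i z‖ ^ α i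

/-- The level set `V = {f_α = ε}` in the complement of the arrangement. -/
def level (ξ : Fin m → EuclideanSpace ℂ (Fin n) →ᵃ[ℂ] ℂ) (α : Fin m → ℝ) (ε : ℝ) :
    Set (EuclideanSpace ℂ (Fin n)) :=
  {z | z ∈ complement ξ ∧ absValue ξ α z = ε}

/-- The logarithmic form `ω_α = ∑ α_i dξ_i / ξ_i`. -/
def logForm (ξ : Fin m → EuclideanSpace ℂ (Fin n) →ᵃ[ℂ] ℂ) (α : Fin m → ℝ)
    (z : EuclideanSpace ℂ (Fin n)) : EuclideanSpace ℂ (Fin n) →L[ℂ] ℂ :=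
  ∑ i, ((α i : ℂ) / ξ i z) • LinearMap.toContinuousLinearMap (ξ i).linear

/-- The real `1`-form `Im ω_α`. -/
def imLogForm (ξ : Fin m → EuclideanSpace ℂ (Fin n) →ᵃ[ℂ] ℂ) (α : Fin m → ℝ)
    (z : EuclideanSpace ℂ (Fin n)) : EuclideanSpace ℂ (Fin n) →L[ℝ] ℝ :=
  Complex.imCLM.comp ((logForm ξ α z).restrictScalars ℝ)

/-- The vector field `ι_α` dual to `Im ω_α` with respect to the real Euclidean scalar product
`Re ⟪·, ·⟫` of `ℂ^n`. -/
def dualField (ξ : Fin m → EuclideanSpace ℂ (Fin n) →ᵃ[ℂ] ℂ) (α : Fin m → ℝ)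
    (z : EuclideanSpace ℂ (Fin n)) : EuclideanSpace ℂ (Fin n) :=
  (InnerProductSpace.toDual ℝ (EuclideanSpace ℂ (Fin n))).symm (imLogForm ξ α z)

/-- The normalized dual vector field `y_α = ι_α / ‖ι_α‖²`. -/
def normalizedDualField (ξ : Fin m → EuclideanSpace ℂ (Fin n) →ᵃ[ℂ] ℂ) (α : Fin m → ℝ)
    (z : EuclideanSpace ℂ (Fin n)) : EuclideanSpace ℂ (Fin n) :=
  (‖dualField ξ α z‖ ^ 2)⁻¹ • dualField ξ α z

/-- The rank of a real vector: the dimension of the `ℚ`-vector space spanned by its components. -/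
def vectorRank (α : Fin m → ℝ) : ℕ :=
  Module.finrank ℚ (Submodule.span ℚ (range α))

end Arr

end Arrangement

end

/-! The form `ω_α` is complex linear on each tangent space and is locally the differential of a
branch of `∑ α_i log ξ_i`, whose real part is `log f_α` up to a constant. Complex linearity gives
`Re ω_α(ι_α) = ⟪ι_α, i ι_α⟫ = 0`, so `ω_α(y_α) = i` wherever `ι_α ≠ 0`. The real part of this
identity says that `y_α` is tangent to the levels of `f_α`; the imaginary part says that any `g`
with `dg = Im ω_α` grows at unit speed along the flow. Once the flow is complete, flowing from a
fibre trivializes `g` away from one point of the circle.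

The analytic heart is completeness, that is, a bound for `‖y_α‖ = 1 / ‖ι_α‖` on `V`. For small `ε`
some `ξ_i` is small on `V`. A pigeonhole on scales separates the small `ξ_i` from the much larger
ones; if `p` is a nearby common zero of the small ones, then `ω_α(z - p)` is close to the sum of the
corresponding `α_i`, hence bounded away from zero (`exists_lower_bound_logForm`). Rescaling and
Cauchy–Schwarz bound `y_α`. As the exponents are positive, `V` is closed in the whole space, and a
bounded tangent field on it is complete (`exists_isCompleteFlow`).

Smoothness of flows is proved by applying the implicit function theorem to the integral equation on
continuous curves (`contDiff_flow`). Rank one serves only to produce `g`: it makes the periods `2π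
α_i` integer multiples of one number. -/

noncomputable section

namespace Arrangement

universe u

/-! ### Smoothness of composition operators on spaces of continuous maps -/

section CompositionOperator

variable {K : Type*} [TopologicalSpace K] [CompactSpace K]
variable {E F : Type*} [NormedAddCommGroup E] [NormedSpace ℝ E]
  [NormedAddCommGroup F] [NormedSpace ℝ F]

/-- Pointwise application of a continuous family of continuous linear maps. -/
def pointwiseApply :
    C(K, E →L[ℝ] F) →L[ℝ] C(K, E) →L[ℝ] C(K, F) :=
  LinearMap.mkContinuous₂
    (LinearMap.mk₂ ℝ (fun (A : C(K, E →L[ℝ] F)) (v : C(K, E)) =>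
        (⟨fun s => A s (v s), by fun_prop⟩ : C(K, F)))
      (fun _ _ _ => by ext; simp) (fun _ _ _ => by ext; simp)
      (fun _ _ _ => by ext; simp) (fun _ _ _ => by ext; simp)) 1
    (fun A v => by
      rw [ContinuousMap.norm_le _ (by positivity)]
      intro s
      calc ‖A s (v s)‖ ≤ ‖A s‖ * ‖v s‖ := (A s).le_opNorm _
        _ ≤ 1 * ‖A‖ * ‖v‖ := by
          rw [one_mul]
          exact mul_le_mul (A.norm_coe_le_norm s) (v.norm_coe_le_norm s) (norm_nonneg _)
            (norm_nonneg A))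

@[simp]
lemma pointwiseApply_apply (A : C(K, E →L[ℝ] F)) (v : C(K, E)) (s : K) :
    pointwiseApply A v s = A s (v s) := rfl

/-- The mean value inequality is applied at each `s`; a radius uniform in `s` exists because `u ↦ X'
∘ u` is continuous in the sup norm. -/
lemma hasFDerivAt_comp_continuousMap {X : C(E, F)} {X' : C(E, E →L[ℝ] F)}
    (hX : ∀ x, HasFDerivAt X (X' x) x) (u : C(K, E)) :
    HasFDerivAt (fun u : C(K, E) => X.comp u) (pointwiseApply (X'.comp u)) u := by
  rw [hasFDerivAt_iff_isLittleO, Asymptotics.isLittleO_iff]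
  intro c hc
  have hcont : Continuous fun u : C(K, E) => X'.comp u := ContinuousMap.continuous_postcomp X'
  obtain ⟨δ, hδ, hball⟩ :=
    (Metric.continuous_iff (α := C(K, E)) (β := C(K, E →L[ℝ] F))).1 hcont u c hc
  filter_upwards [Metric.ball_mem_nhds u hδ] with v hv
  rw [ContinuousMap.norm_le _ (by positivity)]
  intro s
  have hvs : v s ∈ Metric.ball (u s) δ :=
    lt_of_le_of_lt (ContinuousMap.dist_apply_le_dist s) hv
  have hbound : ∀ e ∈ Metric.ball (u s) δ, ‖X' e - X' (u s)‖ ≤ c := by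
    intro e he
    -- Translating `u` by a constant turns sup-norm continuity into an estimate on the whole ball
    -- around `u s`.
    have hd : dist (u + ContinuousMap.const K (e - u s)) u < δ := by
      rw [dist_eq_norm, add_sub_cancel_left]
      refine lt_of_le_of_lt ((ContinuousMap.norm_le _ (norm_nonneg (e - u s))).2 fun _ => le_rfl) ?_
      simpa [dist_eq_norm] using he
    have h1 := (ContinuousMap.dist_apply_le_dist
      (f := X'.comp (u + ContinuousMap.const K (e - u s)))
      (g := X'.comp u) s).trans (hball _ hd).le
    simpa [dist_eq_norm] using h1
  have h2 := (convex_ball (u s) δ).norm_image_sub_le_of_norm_hasFDerivWithin_le'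
    (fun e _ => (hX e).hasFDerivWithinAt) hbound (Metric.mem_ball_self hδ) hvs
  refine le_trans ?_ (h2.trans (mul_le_mul_of_nonneg_left ((v - u).norm_coe_le_norm s) hc.le))
  simp

end CompositionOperator

/-- The composition operator `u ↦ X ∘ u` on continuous maps from a compact space is as smooth
as `X`. -/
theorem contDiff_comp_continuousMap {K : Type*} [TopologicalSpace K] [CompactSpace K]
    {E : Type u} [NormedAddCommGroup E] [NormedSpace ℝ E] (n : ℕ) :
    ∀ {F : Type u} [NormedAddCommGroup F] [NormedSpace ℝ F] (X : C(E, F)), ContDiff ℝ n X →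
      ContDiff ℝ n (fun u : C(K, E) => X.comp u) := by
  induction n with
  | zero =>
    intro F _ _ X _
    exact contDiff_zero.2 (ContinuousMap.continuous_postcomp X)
  | succ n ih =>
    intro F _ _ X hX
    obtain ⟨X', hX', hd⟩ := contDiff_succ_iff_hasFDerivAt.1 (by exact_mod_cast hX)
    push_cast
    rw [contDiff_succ_iff_hasFDerivAt]
    -- The derivative is again built from a composition operator, now with values in `E →L[ℝ] F`.
    -- Hence `F` varies in the induction and shares the universe of `E`.
    refine ⟨fun u => pointwiseApply ((⟨X', hX'.continuous⟩ : C(E, E →L[ℝ] F)).comp u), ?_,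
      fun u => hasFDerivAt_comp_continuousMap hd u⟩
    exact pointwiseApply.contDiff.comp (ih ⟨X', hX'.continuous⟩ hX')

/-! ### Smooth dependence of flows on initial point and time -/

section SmoothFlow

open intervalIntegral

variable {E : Type*} [NormedAddCommGroup E] [NormedSpace ℝ E]

/-- The operator `u ↦ (s ↦ ∫ r in 0..s, u r)` on continuous maps on the unit interval. -/
def primitiveOp : C(unitInterval, E) →L[ℝ] C(unitInterval, E) :=
  LinearMap.mkContinuous
    { toFun := fun u => ⟨fun s => ∫ r in (0 : ℝ)..s, u (projIcc 0 1 zero_le_one r),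
        (continuous_primitive (fun _ _ => Continuous.intervalIntegrable
          (u.continuous.comp continuous_projIcc) _ _) 0).comp continuous_subtype_val⟩
      map_add' := fun u v => by
        ext s
        simpa using integral_add ((u.continuous.comp continuous_projIcc).intervalIntegrable _ _)
          ((v.continuous.comp continuous_projIcc).intervalIntegrable _ _)
      map_smul' := fun c u => by ext s; simp } 1
    (fun u => by
      rw [ContinuousMap.norm_le _ (by positivity)]
      intro s
      refine (norm_integral_le_of_norm_le_const (C := ‖u‖) fun r _ =>
        u.norm_coe_le_norm _).trans ?_
      rw [sub_zero, abs_of_nonneg s.2.1, one_mul]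
      exact mul_le_of_le_one_right (norm_nonneg u) s.2.2)

lemma primitiveOp_apply (u : C(unitInterval, E)) (s : unitInterval) :
    primitiveOp u s = ∫ r in (0 : ℝ)..s, u (projIcc 0 1 zero_le_one r) := rfl

lemma norm_primitiveOp_le : ‖(primitiveOp : C(unitInterval, E) →L[ℝ] _)‖ ≤ 1 :=
  LinearMap.mkContinuous_norm_le _ zero_le_one _

/-- The map whose zeros `((x, τ), u)` are the solutions `u` on the unit interval of the initial
value problem `u' = τ X(u)`, `u 0 = x`. -/
def curveEquation (X : C(E, E)) (p : (E × ℝ) × C(unitInterval, E)) : C(unitInterval, E) :=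
  p.2 - ContinuousLinearMap.const (R := ℝ) unitInterval p.1.1 -
    p.1.2 • primitiveOp (X.comp p.2)

lemma contDiff_curveEquation {X : C(E, E)} (hX : ContDiff ℝ ∞ X) :
    ContDiff ℝ ∞ (curveEquation X) := by
  have h : ContDiff ℝ ∞ (fun u : C(unitInterval, E) => X.comp u) :=
    contDiff_infty.2 fun n => contDiff_comp_continuousMap n X (hX.of_le (by exact_mod_cast le_top))
  exact (contDiff_snd.sub ((ContinuousLinearMap.contDiff _).comp
    (contDiff_fst.comp contDiff_fst))).sub ((contDiff_snd.comp contDiff_fst).smul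
      (primitiveOp.contDiff.comp (h.comp contDiff_snd)))

/-- Solutions are fixed points of `u ↦ x + τ ∫ X ∘ u`, a contraction with constant `|τ| K < 1`. -/
lemma curveEquation_injective {X : C(E, E)} {K : NNReal} (hK : LipschitzWith K X) {p : E × ℝ}
    (hp : |p.2| * K < 1) {u v : C(unitInterval, E)} (hu : curveEquation X (p, u) = 0)
    (hv : curveEquation X (p, v) = 0) : u = v := by
  have h1 : u - v = p.2 • primitiveOp (X.comp u - X.comp v) := by
    have hu' := sub_eq_zero.1 hu
    have hv' := sub_eq_zero.1 hv
    rw [map_sub, smul_sub, ← hu', ← hv', sub_sub_sub_cancel_right]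
  have h2 : ‖X.comp u - X.comp v‖ ≤ K * ‖u - v‖ := by
    rw [ContinuousMap.norm_le _ (by positivity)]
    intro s
    calc ‖X (u s) - X (v s)‖ ≤ K * ‖u s - v s‖ := hK.norm_sub_le _ _
      _ ≤ K * ‖u - v‖ := by gcongr; exact (u - v).norm_coe_le_norm s
  have h3 : ‖u - v‖ ≤ |p.2| * K * ‖u - v‖ := by
    calc ‖u - v‖ = |p.2| * ‖primitiveOp (X.comp u - X.comp v)‖ := by
          conv_lhs => rw [h1]
          rw [norm_smul, Real.norm_eq_abs]
      _ ≤ |p.2| * (1 * ‖X.comp u - X.comp v‖) := by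
          gcongr
          exact ContinuousLinearMap.le_of_opNorm_le _ norm_primitiveOp_le _
      _ ≤ |p.2| * (1 * (K * ‖u - v‖)) := by gcongr
      _ = _ := by ring
  have h4 : ‖u - v‖ = 0 := by nlinarith [norm_nonneg (u - v)]
  exact sub_eq_zero.1 (norm_eq_zero.1 h4)

/-- The partial derivative in the curve is `1 - T` with `‖T‖ ≤ |τ| K < 1`, invertible by a Neumann
series. -/
lemma isInvertible_fderiv_curveEquation [CompleteSpace E] {X : C(E, E)} (hX : ContDiff ℝ ∞ X)
    {K : ℝ} (hK0 : 0 ≤ K) (hK : ∀ x, ‖fderiv ℝ X x‖ ≤ K) (p : (E × ℝ) × C(unitInterval, E))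
    (hp : |p.1.2| * K < 1) :
    (fderiv ℝ (curveEquation X) p ∘L
      .inr ℝ (E × ℝ) C(unitInterval, E)).IsInvertible := by
  set X' : C(E, E →L[ℝ] E) := ⟨fderiv ℝ X, hX.continuous_fderiv (by simp)⟩
  let T : C(unitInterval, E) →L[ℝ] C(unitInterval, E) :=
    p.1.2 • (primitiveOp ∘L pointwiseApply (X'.comp p.2))
  have hTn : ‖T‖ < 1 := by
    refine lt_of_le_of_lt (ContinuousLinearMap.opNorm_le_bound _ (by positivity) fun v => ?_) hp
    have h1 : ‖pointwiseApply (X'.comp p.2) v‖ ≤ K * ‖v‖ := by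
      rw [ContinuousMap.norm_le _ (by positivity)]
      intro s
      exact ((X' (p.2 s)).le_opNorm _).trans
        (mul_le_mul (hK _) (v.norm_coe_le_norm s) (norm_nonneg _) hK0)
    calc ‖T v‖ = |p.1.2| * ‖primitiveOp (pointwiseApply (X'.comp p.2) v)‖ := by
          rw [← Real.norm_eq_abs, ← norm_smul]; rfl
      _ ≤ |p.1.2| * (1 * ‖pointwiseApply (X'.comp p.2) v‖) := by
          gcongr
          exact ContinuousLinearMap.le_of_opNorm_le _ norm_primitiveOp_le _
      _ ≤ |p.1.2| * (1 * (K * ‖v‖)) := by gcongr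
      _ = _ := by ring
  have h1 : HasFDerivAt (fun u => curveEquation X (p.1, u)) (1 - T) p.2 := by
    have h2 := hasFDerivAt_comp_continuousMap (X := X) (X' := X')
      (fun x => (hX.differentiable (by simp) x).hasFDerivAt) p.2
    exact ((hasFDerivAt_id p.2).sub_const (ContinuousLinearMap.const (R := ℝ) unitInterval
      p.1.1)).fun_sub ((primitiveOp.hasFDerivAt.comp p.2 h2).fun_const_smul p.1.2)
  have h2 : HasFDerivAt (fun u => curveEquation X (p.1, u))
      (fderiv ℝ (curveEquation X) p ∘L .inr ℝ (E × ℝ) C(unitInterval, E)) p.2 :=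
    HasFDerivAt.comp p.2 (g := curveEquation X) (f := fun u => (p.1, u))
      (((contDiff_curveEquation hX).differentiable (by simp)) p).hasFDerivAt
      (hasFDerivAt_prodMk_right p.1 p.2)
  rw [h2.unique h1]
  exact ⟨ContinuousLinearEquiv.ofUnit (Units.oneSub T hTn), rfl⟩

/-- Existence of the global flow of a bounded Lipschitz vector field. -/
lemma exists_flow_of_lipschitz [CompleteSpace E] {X : E → E} {K L : NNReal} (hK : LipschitzWith K X)
    (hL : ∀ x, ‖X x‖ ≤ L) :
    ∃ Φ : E → ℝ → E, ∀ x, Φ x 0 = x ∧ ∀ t, HasDerivAt (Φ x) (X (Φ x t)) t := by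
  have hN : ∀ (N : ℕ) (x : E), ∃ c : ℝ → E, c 0 = x ∧
      ∀ t ∈ Ioo (-(N : ℝ)) N, HasDerivAt c (X (c t)) t := by
    intro N x
    have h0 : (0 : ℝ) ∈ Icc (-(N : ℝ)) N := by simp
    -- At speed at most `L`, a curve stays within distance `L * N` of its origin up to time `N`.
    have hPL : IsPicardLindelof (fun _ => X) ⟨0, h0⟩ x (L * N) 0 L K :=
      IsPicardLindelof.of_time_independent (fun x _ => hL x) hK.lipschitzOnWith (by simp)
    obtain ⟨c, hc0, hc⟩ := hPL.exists_eq_forall_mem_Icc_hasDerivWithinAt₀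
    exact ⟨c, hc0, fun t ht => (hc t (Ioo_subset_Icc_self ht)).hasDerivAt
      (Icc_mem_nhds ht.1 ht.2)⟩
  choose c hc0 hc using hN
  have hagree : ∀ (N M : ℕ) (x : E) (t : ℝ), |t| < N → |t| < M → c N x t = c M x t := by
    intro N M x t hN hM
    have hmin : |t| < min (N : ℝ) M := lt_min hN hM
    have hpos : (0 : ℝ) < min (N : ℝ) M := (abs_nonneg t).trans_lt hmin
    refine ODE_solution_unique_of_mem_Ioo (v := fun _ => X) (s := fun _ => univ) (K := K)
      (a := -min (N : ℝ) M) (b := min (N : ℝ) M) (t₀ := 0) (fun _ _ => hK.lipschitzOnWith)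
      ⟨by linarith, hpos⟩ ?_ ?_ ((hc0 N x).trans (hc0 M x).symm) (abs_lt.1 hmin)
    · intro s hs
      refine ⟨hc N x s ⟨?_, ?_⟩, trivial⟩ <;> linarith [hs.1, hs.2, min_le_left (N : ℝ) M]
    · intro s hs
      refine ⟨hc M x s ⟨?_, ?_⟩, trivial⟩ <;> linarith [hs.1, hs.2, min_le_right (N : ℝ) M]
  have hlt : ∀ t : ℝ, |t| < (⌊|t|⌋₊ + 1 : ℕ) := fun t => by
    push_cast; exact Nat.lt_floor_add_one _
  refine ⟨fun x t => c (⌊|t|⌋₊ + 1) x t, fun x => ⟨hc0 _ x, fun t => ?_⟩⟩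
  refine (hc (⌊|t|⌋₊ + 1) x t (abs_lt.1 (hlt t))).congr_of_eventuallyEq ?_
  filter_upwards [(continuous_abs.isOpen_preimage _ isOpen_Iio).mem_nhds (hlt t)] with s hs
  exact hagree _ _ _ _ (hlt s) hs

section Flow

variable {X : E → E} {Φ : E → ℝ → E} {K : NNReal}

lemma flow_unique (hK : LipschitzWith K X) (h0 : ∀ x, Φ x 0 = x)
    (hd : ∀ x t, HasDerivAt (Φ x) (X (Φ x t)) t) {c : ℝ → E}
    (hc : ∀ t, HasDerivAt c (X (c t)) t) (t : ℝ) : c t = Φ (c 0) t := by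
  have := ODE_solution_unique_univ (v := fun _ => X) (s := fun _ => univ) (K := K) (t₀ := 0)
    (f := c) (g := Φ (c 0)) (fun _ => hK.lipschitzOnWith) (fun t => ⟨hc t, trivial⟩)
    (fun t => ⟨hd _ t, trivial⟩) (h0 _).symm
  exact congrFun this t

lemma flow_add (hK : LipschitzWith K X) (h0 : ∀ x, Φ x 0 = x)
    (hd : ∀ x t, HasDerivAt (Φ x) (X (Φ x t)) t) (x : E) (s t : ℝ) :
    Φ x (s + t) = Φ (Φ x s) t := by
  have := flow_unique hK h0 hd (c := fun t => Φ x (s + t))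
    (fun t => (hd x (s + t)).comp_const_add s t) t
  simpa using this

variable [CompleteSpace E]

/-- The rescaled orbits `s ↦ Φ x (τ s)` on the unit interval solve `curveEquation`. By uniqueness
they coincide with the smooth implicit function; evaluation at `s = 1` gives the flow. -/
lemma contDiffAt_flow_of_small (hX : ContDiff ℝ ∞ X) (hK : ∀ x, ‖fderiv ℝ X x‖ ≤ K)
    (h0 : ∀ x, Φ x 0 = x) (hd : ∀ x t, HasDerivAt (Φ x) (X (Φ x t)) t) (p : E × ℝ)
    (hp : |p.2| * K < 1) : ContDiffAt ℝ ∞ (fun p : E × ℝ => Φ p.1 p.2) p := by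
  set X₀ : C(E, E) := ⟨X, hX.continuous⟩
  have hLip : LipschitzWith K X := lipschitzWith_of_nnnorm_fderiv_le
    (hX.differentiable (by simp)) (fun x => by exact_mod_cast hK x)
  have hcont : ∀ x, Continuous (Φ x) := fun x =>
    continuous_iff_continuousAt.2 fun t => (hd x t).continuousAt
  set U : E × ℝ → C(unitInterval, E) := fun q =>
    ⟨fun s => Φ q.1 (q.2 * s), (hcont _).comp (by fun_prop)⟩
  have hzero : ∀ q, curveEquation X₀ (q, U q) = 0 := by
    intro q
    ext s
    have h1 : ∀ r : ℝ, HasDerivAt (fun r => Φ q.1 (q.2 * r)) (q.2 • X (Φ q.1 (q.2 * r))) r := by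
      intro r
      simpa [Function.comp_def] using (hd q.1 (q.2 * r)).scomp r ((hasDerivAt_id r).const_mul q.2)
    have h2 := integral_eq_sub_of_hasDerivAt (a := 0) (b := (s : ℝ)) (fun r _ => h1 r)
      ((((hX.continuous.comp (hcont q.1)).comp (continuous_const.mul continuous_id)).const_smul
        q.2).intervalIntegrable _ _)
    have h3 : (∫ r in (0 : ℝ)..s, (X₀.comp (U q)) (projIcc 0 1 zero_le_one r)) =
        ∫ r in (0 : ℝ)..s, X (Φ q.1 (q.2 * r)) := by
      refine integral_congr fun r hr => ?_
      rw [uIcc_of_le s.2.1] at hr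
      have : r ∈ Icc (0 : ℝ) 1 := ⟨hr.1, hr.2.trans s.2.2⟩
      simp [projIcc_of_mem _ this, U, X₀]
    rw [integral_smul] at h2
    simp only [mul_zero, h0] at h2
    change Φ q.1 (q.2 * s) - q.1 - q.2 • primitiveOp (X₀.comp (U q)) s = 0
    rw [primitiveOp_apply, h3, h2, sub_self]
  have hF : ContDiffAt ℝ ∞ (curveEquation X₀) (p, U p) :=
    (contDiff_curveEquation (X := X₀) hX).contDiffAt
  have hinv := isInvertible_fderiv_curveEquation (X := X₀) hX K.2 hK (p, U p) hp
  have hsm := hF.contDiffAt_implicitFunction (by simp) hinv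
  have heq : U =ᶠ[𝓝 p] hF.implicitFunction (by simp) hinv := by
    have hnear : ∀ᶠ q : E × ℝ in 𝓝 p, |q.2| * K < 1 :=
      (isOpen_lt (f := fun q : E × ℝ => |q.2| * (K : ℝ)) (by fun_prop)
        continuous_const).mem_nhds hp
    filter_upwards [hnear, hF.eventually_apply_implicitFunction (by simp) hinv] with q hq hq'
    exact curveEquation_injective (X := X₀) hLip hq (hzero q) (hq'.trans (hzero p))
  have h1 : ContDiffAt ℝ ∞ U p := hsm.congr_of_eventuallyEq heq
  have h2 := (ContinuousMap.evalCLM ℝ (1 : unitInterval)).contDiff.contDiffAt.comp p h1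
  convert! h2 using 2 with q
  simp [U]

/-- The flow of a smooth vector field with bounded derivative is smooth. -/
theorem contDiff_flow (hX : ContDiff ℝ ∞ X) (hK : ∀ x, ‖fderiv ℝ X x‖ ≤ K)
    (h0 : ∀ x, Φ x 0 = x) (hd : ∀ x t, HasDerivAt (Φ x) (X (Φ x t)) t) :
    ContDiff ℝ ∞ (fun p : E × ℝ => Φ p.1 p.2) := by
  have hLip : LipschitzWith K X := lipschitzWith_of_nnnorm_fderiv_le
    (hX.differentiable (by simp)) (fun x => by exact_mod_cast hK x)
  have hN : ∀ (N : ℕ) (p : E × ℝ), |p.2| * K < N + 1 →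
      ContDiffAt ℝ ∞ (fun p : E × ℝ => Φ p.1 p.2) p := by
    intro N
    induction N with
    | zero => exact fun p hp => contDiffAt_flow_of_small hX hK h0 hd p (by simpa using hp)
    | succ N ih =>
      intro p hp
      push_cast at hp
      have hN0 : (0 : ℝ) < N + 2 := by positivity
      -- The time is split in proportion `N + 1` to `1`: the first piece falls under the induction
      -- hypothesis, the second under the small-time case.
      have h1 : ContDiffAt ℝ ∞ (fun q : E × ℝ => (Φ q.1 ((N + 1) / (N + 2) * q.2),
          1 / (N + 2) * q.2)) p := by
        refine ContDiffAt.prodMk ?_ (by fun_prop)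
        refine ContDiffAt.comp (g := fun p : E × ℝ => Φ p.1 p.2)
          (f := fun q : E × ℝ => (q.1, ((N : ℝ) + 1) / (N + 2) * q.2)) p (ih _ ?_) (by fun_prop)
        rw [abs_mul, abs_of_pos (by positivity), mul_assoc, div_mul_eq_mul_div, div_lt_iff₀ hN0]
        have : (0 : ℝ) < N + 1 := by positivity
        nlinarith
      have h2 : ContDiffAt ℝ ∞ (fun p : E × ℝ => Φ p.1 p.2)
          (Φ p.1 (((N : ℝ) + 1) / (N + 2) * p.2), 1 / (N + 2) * p.2) := by
        refine contDiffAt_flow_of_small hX hK h0 hd _ ?_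
        rw [abs_mul, abs_of_pos (by positivity), mul_assoc, div_mul_eq_mul_div, div_lt_iff₀ hN0]
        linarith
      refine (ContDiffAt.comp p h2 h1).congr_of_eventuallyEq (Filter.Eventually.of_forall ?_)
      intro q
      simp only [Function.comp_apply]
      rw [← flow_add hLip h0 hd]
      congr 1
      field_simp
      ring
  rw [contDiff_iff_contDiffAt]
  intro p
  obtain ⟨N, hN'⟩ := exists_nat_gt (|p.2| * K)
  exact hN N p (by linarith)

end Flow

/-- A compactly supported smooth vector field has a global smooth flow. -/
theorem exists_smooth_flow_of_hasCompactSupport [CompleteSpace E] {X : E → E} (hX : ContDiff ℝ ∞ X)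
    (hc : HasCompactSupport X) :
    ∃ (Φ : E → ℝ → E) (K : NNReal), LipschitzWith K X ∧ (∀ x, Φ x 0 = x) ∧
      (∀ x t, HasDerivAt (Φ x) (X (Φ x t)) t) ∧ ContDiff ℝ ∞ (fun p : E × ℝ => Φ p.1 p.2) := by
  obtain ⟨L, hL⟩ := hc.exists_bound_of_continuous hX.continuous
  obtain ⟨K, hK⟩ := (hc.fderiv (𝕜 := ℝ)).exists_bound_of_continuous
    (hX.continuous_fderiv (by simp))
  have hK' : ∀ x, ‖fderiv ℝ X x‖ ≤ K.toNNReal := fun x => (hK x).trans (Real.le_coe_toNNReal K)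
  have hLip : LipschitzWith K.toNNReal X := lipschitzWith_of_nnnorm_fderiv_le
    (hX.differentiable (by simp)) (fun x => by exact_mod_cast hK' x)
  obtain ⟨Φ, hΦ⟩ := exists_flow_of_lipschitz hLip (L := L.toNNReal)
    (fun x => (hL x).trans (Real.le_coe_toNNReal L))
  exact ⟨Φ, K.toNNReal, hLip, fun x => (hΦ x).1, fun x => (hΦ x).2,
    contDiff_flow hX hK' (fun x => (hΦ x).1) (fun x => (hΦ x).2)⟩

end SmoothFlow

/-! ### Submersions and embedded submanifolds -/

section Submanifold

open Module

variable {E G : Type*} [NormedAddCommGroup E] [NormedSpace ℝ E] [FiniteDimensional ℝ E]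
  [NormedAddCommGroup G] [NormedSpace ℝ G] [FiniteDimensional ℝ G]

/-- A submersion between finite-dimensional spaces extends near each point to a smooth chart. -/
theorem exists_chart_of_submersion {d : ℕ} (hd : finrank ℝ E = d + finrank ℝ G) {f : E → G}
    {U : Set E} (hU : IsOpen U) (hf : ContDiffOn ℝ ∞ f U) {x : E} (hx : x ∈ U)
    (hs : Function.Surjective (fderiv ℝ f x)) :
    ∃ (φ : OpenPartialHomeomorph E
        (EuclideanSpace ℝ (Fin d) × EuclideanSpace ℝ (Fin (finrank ℝ G))))
      (e : G ≃L[ℝ] EuclideanSpace ℝ (Fin (finrank ℝ G))),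
      x ∈ φ.source ∧ φ.source ⊆ U ∧ ContDiffOn ℝ ∞ φ φ.source ∧
      ContDiffOn ℝ ∞ φ.symm φ.target ∧ ∀ y ∈ φ.source, (φ y).2 = e (f y) := by
  set A : E →L[ℝ] G := fderiv ℝ f x with hA
  have hker : finrank ℝ (LinearMap.ker A.toLinearMap) = d := by
    have h1 := A.toLinearMap.finrank_range_add_finrank_ker
    rw [LinearMap.range_eq_top.2 hs, finrank_top] at h1
    omega
  let e : G ≃L[ℝ] EuclideanSpace ℝ (Fin (finrank ℝ G)) :=
    ContinuousLinearEquiv.ofFinrankEq (by simp)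
  let e₁ : LinearMap.ker A.toLinearMap ≃L[ℝ] EuclideanSpace ℝ (Fin d) :=
    ContinuousLinearEquiv.ofFinrankEq (by simp [hker])
  -- A projection onto the kernel of the derivative supplies the `d` coordinates missing from `f`.
  obtain ⟨p, hp⟩ := (LinearMap.ker A.toLinearMap).subtype.exists_leftInverse_of_injective
    (Submodule.ker_subtype _)
  let P : E →L[ℝ] EuclideanSpace ℝ (Fin d) := (e₁ : _ →L[ℝ] _) ∘L LinearMap.toContinuousLinearMap p
  let F : E → EuclideanSpace ℝ (Fin d) × EuclideanSpace ℝ (Fin (finrank ℝ G)) :=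
    fun y => (P y, e (f y))
  have hF : ContDiffOn ℝ ∞ F U := P.contDiff.contDiffOn.prodMk (e.contDiff.comp_contDiffOn hf)
  let D : E →L[ℝ] EuclideanSpace ℝ (Fin d) × EuclideanSpace ℝ (Fin (finrank ℝ G)) :=
    P.prod ((e : G →L[ℝ] _) ∘L A)
  have hDinj : Function.Injective D := by
    refine (injective_iff_map_eq_zero D).2 fun v hv => ?_
    have hv1 : e₁ (p v) = 0 := congrArg Prod.fst hv
    have hv2 : e (A v) = 0 := congrArg Prod.snd hv
    have hvk : v ∈ LinearMap.ker A.toLinearMap := by simpa using hv2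
    have h3 : p v = ⟨v, hvk⟩ := LinearMap.congr_fun hp ⟨v, hvk⟩
    have h4 : p v = 0 := by simpa using hv1
    simpa [h3] using h4
  let D' : E ≃L[ℝ] EuclideanSpace ℝ (Fin d) × EuclideanSpace ℝ (Fin (finrank ℝ G)) :=
    (LinearEquiv.ofInjectiveOfFinrankEq D.toLinearMap hDinj
      (by simp [hd])).toContinuousLinearEquiv
  have hFx : HasFDerivAt F (D' : E →L[ℝ] _) x := by
    have h1 : HasFDerivAt f A x :=
      ((hf.contDiffAt (hU.mem_nhds hx)).differentiableAt (by simp)).hasFDerivAt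
    exact P.hasFDerivAt.prodMk (e.hasFDerivAt.comp x h1)
  have hFc : ContDiffAt ℝ ∞ F x := hF.contDiffAt (hU.mem_nhds hx)
  -- The chart is restricted to points where the derivative is invertible, so that its inverse is
  -- smooth on the whole target.
  let R : Set (E →L[ℝ] EuclideanSpace ℝ (Fin d) × EuclideanSpace ℝ (Fin (finrank ℝ G))) :=
    range ((↑) : (E ≃L[ℝ] EuclideanSpace ℝ (Fin d) × EuclideanSpace ℝ (Fin (finrank ℝ G))) →
      E →L[ℝ] EuclideanSpace ℝ (Fin d) × EuclideanSpace ℝ (Fin (finrank ℝ G)))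
  have hU' : IsOpen (U ∩ fderiv ℝ F ⁻¹' R) :=
    (hF.continuousOn_fderiv_of_isOpen hU (by simp)).isOpen_inter_preimage hU
      ContinuousLinearEquiv.isOpen
  let φ := (hFc.toOpenPartialHomeomorph F hFx (by simp)).restrOpen _ hU'
  have hsrc : φ.source ⊆ U ∩ fderiv ℝ F ⁻¹' R := fun y hy => hy.2
  refine ⟨φ, e, ⟨hFc.mem_toOpenPartialHomeomorph_source hFx (by simp), hx, ?_⟩,
    fun y hy => (hsrc hy).1, hF.mono fun y hy => (hsrc hy).1, ?_, fun y _ => rfl⟩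
  · exact ⟨D', hFx.fderiv.symm⟩
  · intro q hq
    obtain ⟨hyU, B, hB⟩ := hsrc (φ.map_target hq)
    have hc : ContDiffAt ℝ ∞ F (φ.symm q) := hF.contDiffAt (hU.mem_nhds hyU)
    refine (φ.contDiffAt_symm (f₀' := B) hq ?_ hc).contDiffWithinAt
    change HasFDerivAt F _ _
    rw [hB]
    exact (hc.differentiableAt (by simp)).hasFDerivAt

/-- A set which is locally the zero set of a submersion is an embedded submanifold. -/
theorem isEmbeddedSubmanifold_of_submersion {d : ℕ} (hd : finrank ℝ E = d + finrank ℝ G)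
    {S : Set E} (h : ∀ x ∈ S, ∃ (f : E → G) (U : Set E), IsOpen U ∧ x ∈ U ∧ ContDiffOn ℝ ∞ f U ∧
      Function.Surjective (fderiv ℝ f x) ∧ ∀ y ∈ U, y ∈ S ↔ f y = 0) :
    IsEmbeddedSubmanifold d S := by
  intro x hx
  obtain ⟨f, U, hU, hxU, hf, hs, hS⟩ := h x hx
  obtain ⟨φ, e, hxs, hsU, h1, h2, h3⟩ := exists_chart_of_submersion hd hU hf hxU hs
  exact ⟨_, φ, hxs, h1, h2, fun y hy => by rw [hS y (hsU hy), h3 y hy]; simp⟩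

omit [FiniteDimensional ℝ E] in
/-- On an embedded submanifold, a function with vanishing derivative is locally constant. -/
theorem IsEmbeddedSubmanifold.eventually_eq_of_hasFDerivWithinAt_zero {d : ℕ} {S : Set E}
    (hS : IsEmbeddedSubmanifold d S) {W : Set E} (hW : IsOpen W) {x : E} (hxS : x ∈ S)
    (hxW : x ∈ W) {k : E → ℝ} (hk : ∀ y ∈ S, y ∈ W → HasFDerivWithinAt k (0 : E →L[ℝ] ℝ) S y) :
    ∀ᶠ y in 𝓝[S] x, k y = k x := by
  obtain ⟨m, φ, hxs, -, hsymm, hslice⟩ := hS x hxS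
  have hopen : IsOpen (φ.target ∩ φ.symm ⁻¹' W) := φ.isOpen_inter_preimage_symm hW
  obtain ⟨r, hr, hball⟩ := Metric.isOpen_iff.1 hopen (φ x)
    ⟨φ.map_source hxs, by simpa [φ.left_inv hxs] using hxW⟩
  have hx2 : (φ x).2 = 0 := (hslice x hxs).1 hxS
  have hmem : ∀ c ∈ Metric.ball (φ x).1 r,
      ((c, 0) : EuclideanSpace ℝ (Fin d) × EuclideanSpace ℝ (Fin m)) ∈
        φ.target ∩ φ.symm ⁻¹' W := by
    intro c hc
    refine hball ?_
    rw [Metric.mem_ball, Prod.dist_eq, hx2, dist_self]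
    exact max_lt hc hr
  have hmemS : ∀ c ∈ Metric.ball (φ x).1 r, φ.symm (c, 0) ∈ S := fun c hc =>
    (hslice _ (φ.map_target (hmem c hc).1)).2 (by rw [φ.right_inv (hmem c hc).1])
  -- In the chart `S` becomes a flat slice; a ball of it is convex, so a vanishing derivative forces
  -- constancy there.
  have hder : ∀ c ∈ Metric.ball (φ x).1 r,
      HasFDerivWithinAt (fun c => k (φ.symm (c, 0))) (0 : EuclideanSpace ℝ (Fin d) →L[ℝ] ℝ)
        (Metric.ball (φ x).1 r) c := by
    intro c hc
    have h1 : DifferentiableAt ℝ φ.symm (c, 0) :=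
      (hsymm.contDiffAt (φ.open_target.mem_nhds (hmem c hc).1)).differentiableAt (by simp)
    have h2 : HasFDerivWithinAt (fun c : EuclideanSpace ℝ (Fin d) =>
        φ.symm (c, (0 : EuclideanSpace ℝ (Fin m))))
        (fderiv ℝ φ.symm (c, 0) ∘L .inl ℝ _ _) (Metric.ball (φ x).1 r) c :=
      (h1.hasFDerivAt.comp c (hasFDerivAt_prodMk_left c 0)).hasFDerivWithinAt
    have h3 := (hk _ (hmemS c hc) (hmem c hc).2).comp c h2 hmemS
    rwa [ContinuousLinearMap.zero_comp] at h3
  have hnhds : φ.source ∩ φ ⁻¹' Metric.ball (φ x) r ∈ 𝓝 x :=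
    (φ.isOpen_inter_preimage Metric.isOpen_ball).mem_nhds ⟨hxs, Metric.mem_ball_self hr⟩
  filter_upwards [mem_nhdsWithin_of_mem_nhds hnhds, self_mem_nhdsWithin] with y hy hyS
  have hy2 : (φ y).2 = 0 := (hslice y hy.1).1 hyS
  have hyb : (φ y).1 ∈ Metric.ball (φ x).1 r := by
    have h1 : dist (φ y) (φ x) < r := hy.2
    rw [Prod.dist_eq] at h1
    exact (le_max_left _ _).trans_lt h1
  have h := (convex_ball (φ x).1 r).norm_image_sub_le_of_norm_hasFDerivWithin_le (C := 0) hder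
    (by simp) (Metric.mem_ball_self hr) hyb
  have ex : ((φ x).1, (0 : EuclideanSpace ℝ (Fin m))) = φ x := by rw [← hx2]
  have ey : ((φ y).1, (0 : EuclideanSpace ℝ (Fin m))) = φ y := by rw [← hy2]
  rw [zero_mul, norm_le_zero_iff, sub_eq_zero] at h
  simpa [ex, ey, φ.left_inv hxs, φ.left_inv hy.1] using h

end Submanifold

/-! ### Representatives on the circle -/

section Circle

variable {a : ℝ}

/-- The representative in `[-a/2, a/2[` of a point of the circle `ℝ / aℝ`. -/
def centeredRep (ha : 0 < a) (u : AddCircle a) : ℝ :=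
  have : Fact (0 < a) := ⟨ha⟩
  (AddCircle.equivIco a (-(a / 2)) u : ℝ)

lemma coe_centeredRep (ha : 0 < a) (u : AddCircle a) : (centeredRep ha u : AddCircle a) = u :=
  have : Fact (0 < a) := ⟨ha⟩
  (AddCircle.equivIco a (-(a / 2))).symm_apply_apply u

lemma centeredRep_mem (ha : 0 < a) (u : AddCircle a) :
    centeredRep ha u ∈ Ico (-(a / 2)) (a / 2) := by
  have : Fact (0 < a) := ⟨ha⟩
  have h := (AddCircle.equivIco a (-(a / 2)) u).2
  exact ⟨h.1, h.2.trans_eq (by ring)⟩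

lemma centeredRep_coe (ha : 0 < a) {t : ℝ} (ht : t ∈ Ico (-(a / 2)) (a / 2)) :
    centeredRep ha (t : AddCircle a) = t := by
  have : Fact (0 < a) := ⟨ha⟩
  have ht' : t ∈ Ico (-(a / 2)) (-(a / 2) + a) := ⟨ht.1, ht.2.trans_eq (by ring)⟩
  rw [centeredRep, AddCircle.equivIco_coe_of_mem ht']

lemma coe_half_eq_neg (a : ℝ) : ((a / 2 : ℝ) : AddCircle a) = ((-(a / 2) : ℝ) : AddCircle a) := by
  rw [← sub_eq_zero, ← AddCircle.coe_sub]
  have : a / 2 - -(a / 2) = a := by ring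
  rw [this, AddCircle.coe_period]

lemma centeredRep_coe_half (ha : 0 < a) :
    centeredRep ha ((a / 2 : ℝ) : AddCircle a) = -(a / 2) := by
  rw [coe_half_eq_neg, centeredRep_coe ha ⟨le_rfl, by linarith⟩]

/-- The class of `a / 2` is represented by the left endpoint `-(a / 2)`, the only point of the
half-open window outside the open one. -/
lemma centeredRep_mem_Ioo_iff (ha : 0 < a) (u : AddCircle a) :
    centeredRep ha u ∈ Ioo (-(a / 2)) (a / 2) ↔ u ≠ ((a / 2 : ℝ) : AddCircle a) := by
  constructor
  · rintro h rfl
    rw [centeredRep_coe_half] at h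
    exact lt_irrefl _ h.1
  · intro h
    refine ⟨lt_of_le_of_ne (centeredRep_mem ha u).1 fun h' => h ?_, (centeredRep_mem ha u).2⟩
    rw [coe_half_eq_neg, h', coe_centeredRep]

lemma image_coe_Ioo (ha : 0 < a) (b : ℝ) :
    (fun t : ℝ => (t : AddCircle a)) '' Ioo (b - a / 2) (b + a / 2) =
      {((b + a / 2 : ℝ) : AddCircle a)}ᶜ := by
  ext u
  have key : u ∈ ({((b + a / 2 : ℝ) : AddCircle a)}ᶜ : Set (AddCircle a)) ↔
      centeredRep ha (u - b) ∈ Ioo (-(a / 2)) (a / 2) := by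
    rw [centeredRep_mem_Ioo_iff, mem_compl_singleton_iff, AddCircle.coe_add, Ne, Ne,
      sub_eq_iff_eq_add']
  rw [key]
  constructor
  · rintro ⟨t, ht, rfl⟩
    have ht' : t - b ∈ Ioo (-(a / 2)) (a / 2) := ⟨by linarith [ht.1], by linarith [ht.2]⟩
    simp only
    rwa [← AddCircle.coe_sub, centeredRep_coe ha (Ioo_subset_Ico_self ht')]
  · intro h
    refine ⟨b + centeredRep ha (u - b), ⟨by linarith [h.1], by linarith [h.2]⟩, ?_⟩
    simp only
    rw [AddCircle.coe_add, coe_centeredRep]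
    abel

end Circle

/-! ### Circle-valued maps trivialized by a flow -/

section Fibration

variable {E F G : Type*} [NormedAddCommGroup E] [NormedSpace ℝ E] [NormedAddCommGroup F]
  [NormedSpace ℝ F] [NormedAddCommGroup G] [NormedSpace ℝ G]

lemma IsDiffeoOn.comp {φ : E → F} {χ : F → G} {A : Set E} {B : Set F} {C : Set G}
    (hχ : IsDiffeoOn χ B C) (hφ : IsDiffeoOn φ A B) : IsDiffeoOn (χ ∘ φ) A C := by
  obtain ⟨hb, hs, φ', hφ', hi⟩ := hφ
  obtain ⟨hb₂, hs₂, χ', hχ', hi₂⟩ := hχ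
  have hm' : MapsTo χ' C B := by
    intro z hz
    obtain ⟨y, hy, rfl⟩ := hb₂.surjOn hz
    rwa [hi₂.1 hy]
  exact ⟨hb₂.comp hb, hs₂.comp hs hb.mapsTo, φ' ∘ χ', hφ'.comp hχ' hm',
    hi.comp hi₂ hb.mapsTo hm'⟩

variable {a : ℝ} {S : Set E} {η : E → E →L[ℝ] ℝ} {Y : E → E} {Φ : E → ℝ → E}

omit [NormedAddCommGroup E] [NormedSpace ℝ E] in
lemma mem_preimageIn {g : S → AddCircle a} {U : Set (AddCircle a)} {y : E} :
    y ∈ preimageIn g U ↔ ∃ hy : y ∈ S, g ⟨y, hy⟩ ∈ U := by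
  simp [preimageIn]

omit [NormedAddCommGroup E] [NormedSpace ℝ E] in
lemma preimageIn_subset (g : S → AddCircle a) (U : Set (AddCircle a)) : preimageIn g U ⊆ S := by
  rintro _ ⟨y, _, rfl⟩
  exact y.2

lemma HasDifferential.isSmoothToCircle {g : S → AddCircle a} (hg : HasDifferential g η) :
    IsSmoothToCircle g := by
  intro x hx
  obtain ⟨W, h, hW, hxW, hs, hd⟩ := hg x hx
  exact ⟨W, h, hW, hxW, hs, fun y hy hyW => (hd y hy hyW).1⟩

/-- A flow of a field on which the differential of `g` takes the value `1` translates `g`. -/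
theorem HasDifferential.apply_flow {g : S → AddCircle a} (hg : HasDifferential g η)
    (hΦ : IsCompleteFlow Y S Φ) (hη : ∀ x ∈ S, η x (Y x) = 1) {x : E} (hx : x ∈ S) (t : ℝ) :
    g ⟨Φ x t, hΦ.mem x hx t⟩ = g ⟨x, hx⟩ + (t : AddCircle a) := by
  have hcont : Continuous (Φ x) :=
    continuous_iff_continuousAt.2 fun t => (hΦ.deriv x hx t).continuousAt
  -- Locally `g` lifts to `h` with `d/dt h(Φ x t) = η(Y) = 1`, so `g(Φ x t) - t` is locally constant
  -- on the connected line.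
  have hloc : IsLocallyConstant
      (fun t : ℝ => g ⟨Φ x t, hΦ.mem x hx t⟩ - (t : AddCircle a)) := by
    rw [IsLocallyConstant.iff_eventually_eq]
    intro t₀
    obtain ⟨W, h, hW, hxW, -, hd⟩ := hg _ (hΦ.mem x hx t₀)
    obtain ⟨r, hr, hball⟩ := Metric.isOpen_iff.1 (hW.preimage hcont) t₀ hxW
    have hder : ∀ t ∈ Metric.ball t₀ r,
        HasDerivWithinAt (fun t => h (Φ x t) - t) 0 (Metric.ball t₀ r) t := by
      intro t ht
      have h1 := (hd _ (hΦ.mem x hx t) (hball ht)).2.comp_hasDerivWithinAt t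
        (hΦ.deriv x hx t).hasDerivWithinAt (fun s _ => hΦ.mem x hx s)
        (s := Metric.ball t₀ r)
      rw [hη _ (hΦ.mem x hx t)] at h1
      simpa using h1.fun_sub (hasDerivWithinAt_id t _)
    filter_upwards [Metric.ball_mem_nhds t₀ hr] with t ht
    have h1 := (convex_ball t₀ r).norm_image_sub_le_of_norm_hasDerivWithin_le (C := 0) hder
      (by simp) (Metric.mem_ball_self hr) ht
    rw [zero_mul, norm_le_zero_iff, sub_eq_zero] at h1
    rw [← (hd _ (hΦ.mem x hx t) (hball ht)).1, ← (hd _ (hΦ.mem x hx t₀) hxW).1,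
      ← AddCircle.coe_sub, ← AddCircle.coe_sub, h1]
  have h0 := hloc.apply_eq_of_preconnectedSpace t 0
  simp only [hΦ.zero x hx, AddCircle.coe_zero, sub_zero] at h0
  rw [← h0, sub_add_cancel]

/-- Away from the cut, `s` and a suitably shifted smooth lift of `g` both lie in the open window of
length `a` and agree modulo `a`, hence coincide. -/
lemma HasDifferential.contDiffOn_centeredRep {g : S → AddCircle a} (hg : HasDifferential g η)
    (ha : 0 < a) (b : ℝ) {s : E → ℝ}
    (hs : ∀ y (hy : y ∈ S), s y = centeredRep ha (g ⟨y, hy⟩ - (b : AddCircle a))) :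
    ContDiffOn ℝ ∞ s (preimageIn g ({((b + a / 2 : ℝ) : AddCircle a)}ᶜ)) := by
  intro y₀ hy₀
  obtain ⟨hS₀, hne⟩ := mem_preimageIn.1 hy₀
  obtain ⟨W, h, hW, hxW, hsm, hd⟩ := hg y₀ hS₀
  have hsm₀ : ContDiffWithinAt ℝ ∞ h S y₀ :=
    (hsm y₀ ⟨hS₀, hxW⟩).mono_of_mem_nhdsWithin (inter_mem_nhdsWithin S (hW.mem_nhds hxW))
  have hk : ContDiffWithinAt ℝ ∞ (fun y => h y - h y₀ + s y₀) S y₀ :=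
    (hsm₀.sub contDiffWithinAt_const).add contDiffWithinAt_const
  have hs₀ : s y₀ ∈ Ioo (-(a / 2)) (a / 2) := by
    rw [hs y₀ hS₀, centeredRep_mem_Ioo_iff]
    rw [mem_compl_singleton_iff, AddCircle.coe_add] at hne
    rwa [Ne, sub_eq_iff_eq_add']
  have hev : ∀ᶠ y in 𝓝[S] y₀, h y - h y₀ + s y₀ ∈ Ioo (-(a / 2)) (a / 2) :=
    hk.continuousWithinAt.eventually (isOpen_Ioo.mem_nhds (by simpa using hs₀))
  have heq : s =ᶠ[𝓝[S] y₀] fun y => h y - h y₀ + s y₀ := by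
    filter_upwards [hev, self_mem_nhdsWithin, mem_nhdsWithin_of_mem_nhds (hW.mem_nhds hxW)]
      with y hy hyS hyW
    rw [hs y hyS, ← centeredRep_coe ha (Ioo_subset_Ico_self hy), AddCircle.coe_add,
      AddCircle.coe_sub, (hd y hyS hyW).1, (hd y₀ hS₀ hxW).1, hs y₀ hS₀, coe_centeredRep]
    congr 1
    abel
  exact (hk.congr_of_eventuallyEq heq (by simp)).mono (preimageIn_subset g _)

/-- The flow trivializes `g` over the complement of a point of the circle. -/
theorem HasDifferential.isDiffeoOn_flow {g : S → AddCircle a} (hg : HasDifferential g η)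
    (ha : 0 < a) (hΦ : IsCompleteFlow Y S Φ) (hη : ∀ x ∈ S, η x (Y x) = 1)
    (hadd : ∀ x ∈ S, ∀ s t, Φ (Φ x s) t = Φ x (s + t)) (b : ℝ) :
    IsDiffeoOn (fun p : E × ℝ => Φ p.1 p.2)
      (preimageIn g {(b : AddCircle a)} ×ˢ Ioo (-(a / 2)) (a / 2))
      (preimageIn g ({((b + a / 2 : ℝ) : AddCircle a)}ᶜ : Set (AddCircle a))) := by
  classical
  let s : E → ℝ := fun y =>
    if hy : y ∈ S then centeredRep ha (g ⟨y, hy⟩ - (b : AddCircle a)) else 0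
  have hs : ∀ y (hy : y ∈ S), s y = centeredRep ha (g ⟨y, hy⟩ - (b : AddCircle a)) :=
    fun y hy => dif_pos hy
  have hmap : MapsTo (fun p : E × ℝ => Φ p.1 p.2)
      (preimageIn g {(b : AddCircle a)} ×ˢ Ioo (-(a / 2)) (a / 2))
      (preimageIn g ({((b + a / 2 : ℝ) : AddCircle a)}ᶜ : Set (AddCircle a))) := by
    rintro ⟨x, t⟩ ⟨hx, ht⟩
    obtain ⟨hxS, hgx⟩ := mem_preimageIn.1 hx
    refine mem_preimageIn.2 ⟨hΦ.mem x hxS t, ?_⟩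
    rw [hg.apply_flow hΦ hη hxS t, mem_singleton_iff.1 hgx, mem_compl_singleton_iff,
      AddCircle.coe_add, Ne, add_right_inj, ← Ne, ← centeredRep_mem_Ioo_iff ha,
      centeredRep_coe ha (Ioo_subset_Ico_self ht)]
    exact ht
  -- The number `s y` is the time needed to reach `y` from the fibre over `b`; flowing back for that
  -- time inverts the trivialization.
  have hmap' : MapsTo (fun y => (Φ y (-s y), s y))
      (preimageIn g ({((b + a / 2 : ℝ) : AddCircle a)}ᶜ : Set (AddCircle a)))
      (preimageIn g {(b : AddCircle a)} ×ˢ Ioo (-(a / 2)) (a / 2)) := by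
    intro y hy
    obtain ⟨hyS, hgy⟩ := mem_preimageIn.1 hy
    refine ⟨mem_preimageIn.2 ⟨hΦ.mem y hyS _, ?_⟩, ?_⟩
    · rw [hg.apply_flow hΦ hη hyS, mem_singleton_iff, hs y hyS, AddCircle.coe_neg,
        coe_centeredRep]
      abel
    · simp only
      rw [hs y hyS, centeredRep_mem_Ioo_iff, Ne, sub_eq_iff_eq_add', ← AddCircle.coe_add]
      exact hgy
  have hinv : InvOn (fun y => (Φ y (-s y), s y)) (fun p : E × ℝ => Φ p.1 p.2)
      (preimageIn g {(b : AddCircle a)} ×ˢ Ioo (-(a / 2)) (a / 2))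
      (preimageIn g ({((b + a / 2 : ℝ) : AddCircle a)}ᶜ : Set (AddCircle a))) := by
    constructor
    · rintro ⟨x, t⟩ ⟨hx, ht⟩
      obtain ⟨hxS, hgx⟩ := mem_preimageIn.1 hx
      have hst : s (Φ x t) = t := by
        rw [hs _ (hΦ.mem x hxS t), hg.apply_flow hΦ hη hxS t, mem_singleton_iff.1 hgx,
          add_sub_cancel_left, centeredRep_coe ha (Ioo_subset_Ico_self ht)]
      simp only [hst, hadd x hxS, add_neg_cancel, hΦ.zero x hxS]
    · intro y hy
      have hyS := preimageIn_subset g _ hy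
      simp only [hadd y hyS, neg_add_cancel, hΦ.zero y hyS]
  refine ⟨hinv.bijOn hmap hmap', hΦ.smooth.mono
    (prod_mono (preimageIn_subset g _) (subset_univ _)), _, ?_, hinv⟩
  have hsm := hg.contDiffOn_centeredRep ha b hs
  exact (hΦ.smooth.comp (contDiffOn_id.prodMk hsm.neg)
    (fun y hy => ⟨preimageIn_subset g _ hy, trivial⟩)).prodMk hsm

/-- A circle-valued map whose differential takes the value `1` on a complete field is a locally
trivial fibration, as soon as its fibres are submanifolds. -/
theorem HasDifferential.isLocallyTrivialSmoothFibration {g : S → AddCircle a}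
    (hg : HasDifferential g η) (ha : 0 < a) (hS : S.Nonempty) (hΦ : IsCompleteFlow Y S Φ)
    (hη : ∀ x ∈ S, η x (Y x) = 1) (hadd : ∀ x ∈ S, ∀ s t, Φ (Φ x s) t = Φ x (s + t)) {d : ℕ}
    (hfib : ∀ c, IsEmbeddedSubmanifold d (preimageIn g {c})) :
    IsLocallyTrivialSmoothFibration d g := by
  refine ⟨hg.isSmoothToCircle, fun c => ?_, hfib, fun b => ⟨a / 2, by positivity, by linarith,
    (fun p : E × ℝ => Φ p.1 p.2) ∘ fun p => (p.1, p.2 - b), ?_, ?_⟩⟩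
  · obtain ⟨x, hx⟩ := hS
    refine ⟨⟨Φ x (centeredRep ha (c - g ⟨x, hx⟩)), hΦ.mem x hx _⟩, ?_⟩
    rw [hg.apply_flow hΦ hη hx, coe_centeredRep]
    abel
  · rw [image_coe_Ioo ha]
    refine (hg.isDiffeoOn_flow ha hΦ hη hadd b).comp ?_
    have hinv : InvOn (fun p : E × ℝ => (p.1, p.2 + b)) (fun p : E × ℝ => (p.1, p.2 - b))
        (preimageIn g {(b : AddCircle a)} ×ˢ Ioo (b - a / 2) (b + a / 2))
        (preimageIn g {(b : AddCircle a)} ×ˢ Ioo (-(a / 2)) (a / 2)) :=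
      ⟨fun p _ => by simp, fun p _ => by simp⟩
    refine ⟨hinv.bijOn ?_ ?_, ContDiff.contDiffOn (by fun_prop), _,
      ContDiff.contDiffOn (by fun_prop), hinv⟩
    · rintro ⟨x, t⟩ ⟨hx, ht⟩
      exact ⟨hx, by linarith [ht.1], by linarith [ht.2]⟩
    · rintro ⟨x, t⟩ ⟨hx, ht⟩
      exact ⟨hx, by linarith [ht.1], by linarith [ht.2]⟩
  · intro x hx t ht
    obtain ⟨hxS, hgx⟩ := mem_preimageIn.1 hx
    refine ⟨hΦ.mem x hxS _, ?_⟩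
    simp only [Function.comp_apply]
    rw [hg.apply_flow hΦ hη hxS, mem_singleton_iff.1 hgx, ← AddCircle.coe_add, add_sub_cancel]

end Fibration

/-! ### Complete flows on closed level sets -/

section CompleteFlow

variable {E : Type*} [NormedAddCommGroup E] [NormedSpace ℝ E] [FiniteDimensional ℝ E]

open scoped Manifold in
/-- A compact subset of an open set carries a smooth plateau function supported in the open set. -/
lemma exists_smooth_plateau {K U : Set E} (hK : IsCompact K) (hU : IsOpen U) (hKU : K ⊆ U) :
    ∃ χ : E → ℝ, ContDiff ℝ ∞ χ ∧ HasCompactSupport χ ∧ tsupport χ ⊆ U ∧ (∀ x ∈ K, χ x = 1) ∧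
      ∀ x, χ x ∈ Icc (0 : ℝ) 1 := by
  have : ProperSpace E := FiniteDimensional.proper ℝ E
  obtain ⟨L, hL, hKL, hLU⟩ := exists_compact_between hK hU hKU
  obtain ⟨f, h1, h0, hf⟩ := exists_contMDiffMap_one_nhds_of_subset_interior (n := ⊤) 𝓘(ℝ, E)
    hK.isClosed hKL
  have hs : tsupport f ⊆ L := closure_minimal
    (fun x hx => by_contra fun hxL => hx (h0 x hxL)) hL.isClosed
  exact ⟨f, f.contMDiff.contDiff, hL.of_isClosed_subset (isClosed_tsupport f) hs, hs.trans hLU,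
    fun x hx => h1.self_of_nhdsSet x hx, hf⟩

omit [FiniteDimensional ℝ E] in
/-- A curve tangent to the levels of `ℓ` does not leave a closed level of `ℓ`. -/
lemma mem_of_tangent {S U : Set E} (hS : IsClosed S) (hU : IsOpen U) (hSU : S ⊆ U) {ℓ : E → ℝ}
    {ℓ' : E → E →L[ℝ] ℝ} (hℓ : ∀ y ∈ U, HasFDerivAt ℓ (ℓ' y) y)
    (hlevel : ∀ y ∈ U, y ∈ S ↔ ℓ y = 0) {c c' : ℝ → E} (hc : ∀ t, HasDerivAt c (c' t) t)
    (htan : ∀ t, c t ∈ U → ℓ' (c t) (c' t) = 0) (h0 : c 0 ∈ S) (t : ℝ) : c t ∈ S := by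
  have hcont : Continuous c := continuous_iff_continuousAt.2 fun t => (hc t).continuousAt
  -- The set of times spent in `S` is closed because `S` is, and open because `ℓ ∘ c` has zero
  -- derivative near each of its points.
  have hclopen : IsClopen (c ⁻¹' S) := by
    refine ⟨hS.preimage hcont, isOpen_iff_mem_nhds.2 fun t₀ ht₀ => ?_⟩
    obtain ⟨r, hr, hball⟩ := Metric.isOpen_iff.1 (hU.preimage hcont) t₀ (hSU ht₀)
    have hder : ∀ t ∈ Metric.ball t₀ r, HasDerivWithinAt (ℓ ∘ c) 0 (Metric.ball t₀ r) t := by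
      intro t ht
      have h1 := (hℓ _ (hball ht)).comp_hasDerivAt t (hc t)
      rw [htan t (hball ht)] at h1
      exact h1.hasDerivWithinAt
    filter_upwards [Metric.ball_mem_nhds t₀ hr] with t ht
    have h1 := (convex_ball t₀ r).norm_image_sub_le_of_norm_hasDerivWithin_le (C := 0) hder
      (by simp) (Metric.mem_ball_self hr) ht
    rw [zero_mul, norm_le_zero_iff, sub_eq_zero] at h1
    exact (hlevel _ (hball ht)).2 (h1.trans ((hlevel _ (hSU ht₀)).1 ht₀))
  have huniv := hclopen.eq_univ ⟨0, h0⟩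
  exact huniv.symm.subset (mem_univ t)

/-- A smooth vector field which is bounded along a closed level set and tangent to the level sets
has a complete smooth flow on the given level set. -/
theorem exists_isCompleteFlow {S U : Set E} (hS : IsClosed S) (hU : IsOpen U) (hSU : S ⊆ U)
    {Y : E → E} (hY : ContDiffOn ℝ ∞ Y U) {B : ℝ} (hB : ∀ x ∈ S, ‖Y x‖ ≤ B) {ℓ : E → ℝ}
    {ℓ' : E → E →L[ℝ] ℝ} (hℓ : ∀ y ∈ U, HasFDerivAt ℓ (ℓ' y) y)
    (hlevel : ∀ y ∈ U, y ∈ S ↔ ℓ y = 0) (htan : ∀ y ∈ U, ℓ' y (Y y) = 0) :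
    ∃ Φ : E → ℝ → E, IsCompleteFlow Y S Φ ∧ ∀ x ∈ S, ∀ s t, Φ (Φ x s) t = Φ x (s + t) := by
  have : ProperSpace E := FiniteDimensional.proper ℝ E
  have : CompleteSpace E := FiniteDimensional.complete ℝ E
  wlog hB0 : 0 < B generalizing B
  · exact this (B := max B 1) (fun x hx => (hB x hx).trans (le_max_left _ _)) (by positivity)
  -- The field is cut off to compact support but kept unchanged on `S` within radius `N`. The
  -- cut-off flow `Ψ N` preserves `S` and has speed at most `B` there, so it follows `Y` as long as
  -- `‖x‖ + B * |t| < N`.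
  have hplateau : ∀ N : ℕ, ∃ χ : E → ℝ, ContDiff ℝ ∞ χ ∧ HasCompactSupport χ ∧ tsupport χ ⊆ U ∧
      (∀ x ∈ S ∩ Metric.closedBall 0 (N : ℝ), χ x = 1) ∧ ∀ x, χ x ∈ Icc (0 : ℝ) 1 := fun N =>
    exists_smooth_plateau ((isCompact_closedBall 0 (N : ℝ)).inter_left hS) hU
      (inter_subset_left.trans hSU)
  choose χ hχs hχc hχU hχ1 hχI using hplateau
  have hflow : ∀ N : ℕ, ∃ (Φ : E → ℝ → E) (K : NNReal), LipschitzWith K (fun x => χ N x • Y x) ∧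
      (∀ x, Φ x 0 = x) ∧ (∀ x t, HasDerivAt (Φ x) (χ N (Φ x t) • Y (Φ x t)) t) ∧
      ContDiff ℝ ∞ (fun p : E × ℝ => Φ p.1 p.2) := by
    intro N
    refine exists_smooth_flow_of_hasCompactSupport (X := fun x => χ N x • Y x) ?_
      (hχc N).smul_right
    rw [contDiff_iff_contDiffAt]
    intro x
    by_cases hx : x ∈ U
    · exact (hχs N).contDiffAt.smul (hY.contDiffAt (hU.mem_nhds hx))
    · have h1 : χ N =ᶠ[𝓝 x] 0 := notMem_tsupport_iff_eventuallyEq.1 fun h => hx (hχU N h)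
      refine (contDiffAt_const (c := (0 : E))).congr_of_eventuallyEq ?_
      filter_upwards [h1] with y hy
      simp [hy]
  choose Ψ K hLip hΨ0 hΨd hΨs using hflow
  have hmem : ∀ N, ∀ x ∈ S, ∀ t, Ψ N x t ∈ S := fun N x hx t =>
    mem_of_tangent hS hU hSU hℓ hlevel (hΨd N x)
      (fun t ht => by rw [map_smul, htan _ ht, smul_zero]) (by rwa [hΨ0]) t
  have hspeed : ∀ N, ∀ x ∈ S, ∀ t, ‖Ψ N x t - x‖ ≤ B * |t| := by
    intro N x hx t
    have h1 := convex_univ.norm_image_sub_le_of_norm_hasDerivWithin_le (C := B) (f := Ψ N x)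
      (x := 0) (y := t) (fun s _ => (hΨd N x s).hasDerivWithinAt) (fun s _ => ?_)
      (mem_univ _) (mem_univ _)
    · simpa [hΨ0] using h1
    · rw [norm_smul, Real.norm_eq_abs, abs_of_nonneg (hχI N _).1]
      exact (mul_le_of_le_one_left (norm_nonneg _) (hχI N _).2).trans (hB _ (hmem N x hx s))
  have hone : ∀ N M : ℕ, ∀ x ∈ S, ∀ t, ‖x‖ + B * |t| < N → N ≤ M → χ M (Ψ N x t) = 1 := by
    intro N M x hx t ht hNM
    refine hχ1 M _ ⟨hmem N x hx t, ?_⟩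
    rw [mem_closedBall_zero_iff]
    have h1 := norm_le_norm_add_norm_sub' (Ψ N x t) x
    have h2 : (N : ℝ) ≤ M := by exact_mod_cast hNM
    linarith [hspeed N x hx t]
  have hagree_le : ∀ N M : ℕ, N ≤ M → ∀ x ∈ S, ∀ t, ‖x‖ + B * |t| < N → Ψ N x t = Ψ M x t := by
    intro N M hNM x hx t ht
    set T : ℝ := (N - ‖x‖) / B with hT
    have hlt : ∀ s, |s| < T → ‖x‖ + B * |s| < N := by
      intro s hs
      rw [hT, lt_div_iff₀ hB0] at hs
      linarith
    have htT : |t| < T := by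
      rw [hT, lt_div_iff₀ hB0]
      linarith
    have hT0 : 0 < T := (abs_nonneg t).trans_lt htT
    refine ODE_solution_unique_of_mem_Ioo (v := fun _ x => χ M x • Y x) (s := fun _ => univ)
      (K := K M) (a := -T) (b := T) (t₀ := 0) (fun _ _ => (hLip M).lipschitzOnWith)
      ⟨by linarith, hT0⟩ (fun s hs => ⟨?_, trivial⟩) (fun s _ => ⟨hΨd M x s, trivial⟩)
      ((hΨ0 N x).trans (hΨ0 M x).symm) (abs_lt.1 htT)
    have hs' := hlt s (abs_lt.2 hs)
    have h1 := hΨd N x s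
    rw [hone N N x hx s hs' le_rfl] at h1
    rwa [hone N M x hx s hs' hNM]
  have hagree : ∀ N M : ℕ, ∀ x ∈ S, ∀ t, ‖x‖ + B * |t| < N → ‖x‖ + B * |t| < M →
      Ψ N x t = Ψ M x t := by
    intro N M x hx t hN hM
    rcases le_total N M with h | h
    · exact hagree_le N M h x hx t hN
    · exact (hagree_le M N h x hx t hM).symm
  -- All `N` beyond `‖x‖ + B * |t|` give the same value; near a given `(x, t)` a fixed `N` may be
  -- used, which yields smoothness.
  let ν : E → ℝ → ℕ := fun x t => ⌊‖x‖ + B * |t|⌋₊ + 1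
  have hν : ∀ x t, ‖x‖ + B * |t| < ν x t := fun x t => by
    simpa [ν] using Nat.lt_floor_add_one (‖x‖ + B * |t|)
  have hΦ : ∀ N : ℕ, ∀ x ∈ S, ∀ t, ‖x‖ + B * |t| < N → Ψ (ν x t) x t = Ψ N x t :=
    fun N x hx t h => hagree _ _ x hx t (hν x t) h
  refine ⟨fun x t => Ψ (ν x t) x t, ⟨fun x hx t => hmem _ x hx t, fun x _ => hΨ0 _ x, ?_, ?_⟩, ?_⟩
  · intro x hx t
    have h1 := hΨd (ν x t) x t
    rw [hone _ _ x hx t (hν x t) le_rfl, one_smul] at h1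
    refine h1.congr_of_eventuallyEq ?_
    have hopen : IsOpen {s : ℝ | ‖x‖ + B * |s| < ν x t} :=
      isOpen_lt (by fun_prop) continuous_const
    filter_upwards [hopen.mem_nhds (hν x t)] with s hs
    exact hΦ _ x hx s hs
  · rintro ⟨x, t⟩ ⟨hx, -⟩
    refine (hΨs (ν x t)).contDiffWithinAt.congr_of_eventuallyEq ?_ rfl
    have hopen : IsOpen {q : E × ℝ | ‖q.1‖ + B * |q.2| < ν x t} :=
      isOpen_lt (by fun_prop) continuous_const
    filter_upwards [self_mem_nhdsWithin, mem_nhdsWithin_of_mem_nhds (hopen.mem_nhds (hν x t))]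
      with q hqS hq
    exact hΦ _ q.1 hqS.1 q.2 hq
  · intro x hx s t
    -- One `N` large enough for all three evaluations reduces the claim to the group law of `Ψ N`.
    obtain ⟨N, hN⟩ := exists_nat_gt (‖x‖ + B * |s| + B * |t| + (‖Ψ (ν x s) x s‖ + B * |t|))
    have e1 := norm_nonneg x
    have e2 := mul_nonneg hB0.le (abs_nonneg s)
    have e3 := mul_nonneg hB0.le (abs_nonneg t)
    have e4 := norm_nonneg (Ψ (ν x s) x s)
    have e5 := mul_le_mul_of_nonneg_left (abs_add_le s t) hB0.le
    simp only
    rw [hΦ N _ (hmem _ x hx s) t (by linarith), hΦ N x hx (s + t) (by linarith),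
      hΦ N x hx s (by linarith)]
    exact (flow_add (hLip N) (hΨ0 N) (hΨd N) x s t).symm

end CompleteFlow

/-! ### Lower bound for the logarithmic form near the hyperplanes -/

section LowerBound

/-- A point at which an affine map is small is close to a zero of this map. -/
lemma exists_zero_near {V F : Type*} [NormedAddCommGroup V] [NormedSpace ℂ V]
    [FiniteDimensional ℂ V] [NormedAddCommGroup F] [NormedSpace ℂ F] [FiniteDimensional ℂ F]
    (A : V →ᵃ[ℂ] F) :
    ∃ C δ : ℝ, 0 < C ∧ 0 < δ ∧ ∀ z, ‖A z‖ < δ → ∃ p, A p = 0 ∧ ‖z - p‖ ≤ C * ‖A z‖ := by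
  by_cases h0 : ∃ p₀, A p₀ = 0
  · obtain ⟨p₀, hp₀⟩ := h0
    obtain ⟨r, hr⟩ := A.linear.rangeRestrict.exists_rightInverse_of_surjective
      A.linear.range_rangeRestrict
    let R := LinearMap.toContinuousLinearMap r
    refine ⟨‖R‖ + 1, 1, by positivity, one_pos, fun z _ => ?_⟩
    have hz : A.linear (z - p₀) = A z := by
      have := A.linearMap_vsub z p₀
      simpa [hp₀] using this
    have hRz : A.linear (r (A.linear.rangeRestrict (z - p₀))) = A.linear (z - p₀) :=
      congrArg Subtype.val (LinearMap.congr_fun hr (A.linear.rangeRestrict (z - p₀)))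
    refine ⟨z - r (A.linear.rangeRestrict (z - p₀)), ?_, ?_⟩
    · have := A.linearMap_vsub z (z - r (A.linear.rangeRestrict (z - p₀)))
      simp only [vsub_eq_sub, sub_sub_cancel] at this
      rw [hRz, hz] at this
      exact sub_eq_self.1 this.symm
    · rw [sub_sub_cancel]
      calc ‖R (A.linear.rangeRestrict (z - p₀))‖
          ≤ ‖R‖ * ‖A.linear.rangeRestrict (z - p₀)‖ := R.le_opNorm _
        _ = ‖R‖ * ‖A z‖ := by rw [← hz]; rfl
        _ ≤ (‖R‖ + 1) * ‖A z‖ := by gcongr; linarith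
  -- Without a zero, `-A 0` has positive distance to the closed range of the linear part, and `‖A z‖
  -- < δ` never occurs.
  · have hcl : IsClosed (LinearMap.range A.linear : Set F) :=
      Submodule.closed_of_finiteDimensional _
    have hdec : ∀ z, A z = A.linear z + A 0 := fun z => by
      have := A.linearMap_vsub z 0
      simp only [vsub_eq_sub, sub_zero] at this
      rw [this, sub_add_cancel]
    have hmem : -A 0 ∈ (LinearMap.range A.linear : Set F)ᶜ := by
      rintro ⟨z, hz⟩
      exact h0 ⟨z, by rw [hdec, hz, neg_add_cancel]⟩
    obtain ⟨δ, hδ, hball⟩ := Metric.isOpen_iff.1 hcl.isOpen_compl _ hmem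
    refine ⟨1, δ, one_pos, hδ, fun z hz => absurd (LinearMap.mem_range_self A.linear z) (hball ?_)⟩
    rwa [mem_ball_iff_norm, sub_neg_eq_add, ← hdec]

variable {n m : ℕ}

/-- `exists_zero_near` applies to the tuple of the `ξ i`, `i ∈ I`; as there are finitely many `I`,
the constants can be made uniform. -/
lemma exists_common_zero_near (ξ : Fin m → EuclideanSpace ℂ (Fin n) →ᵃ[ℂ] ℂ) :
    ∃ C δ : ℝ, 0 < C ∧ 0 < δ ∧ ∀ (I : Finset (Fin m)) (z : EuclideanSpace ℂ (Fin n)) (s : ℝ),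
      0 ≤ s → s < δ → (∀ i ∈ I, ‖ξ i z‖ ≤ s) →
        ∃ p, (∀ i ∈ I, ξ i p = 0) ∧ ‖z - p‖ ≤ C * s := by
  have h := fun I : Finset (Fin m) => exists_zero_near (AffineMap.pi fun i : I => ξ i)
  choose C δ hC hδ hI using h
  refine ⟨∑ I, C I, Finset.univ.inf' Finset.univ_nonempty δ,
    Finset.sum_pos (fun I _ => hC I) Finset.univ_nonempty,
    (Finset.lt_inf'_iff _).2 fun I _ => hδ I, fun I z s hs0 hs hz => ?_⟩
  have hnorm : ‖(AffineMap.pi fun i : I => ξ i) z‖ ≤ s :=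
    (pi_norm_le_iff_of_nonneg hs0).2 fun i => hz i i.2
  obtain ⟨p, hp, hzp⟩ := hI I z
    (hnorm.trans_lt (hs.trans_le (Finset.inf'_le _ (Finset.mem_univ I))))
  refine ⟨p, fun i hi => congrFun hp ⟨i, hi⟩, hzp.trans ?_⟩
  exact mul_le_mul (Finset.single_le_sum (fun J _ => (hC J).le) (Finset.mem_univ I)) hnorm
    (norm_nonneg _) (Finset.sum_nonneg fun J _ => (hC J).le)

/-- An increasing chain of `m + 1` subsets of `Fin m`, the first being non-empty, is somewhere
stationary. -/
lemma exists_stationary {I : ℕ → Finset (Fin m)} (h0 : (I 0).Nonempty)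
    (hmono : ∀ k, I k ⊆ I (k + 1)) : ∃ k ≤ m, I k = I (k + 1) := by
  by_contra! hne
  have hcard : ∀ k ≤ m, k + 1 ≤ (I k).card := by
    intro k
    induction k with
    | zero => exact fun _ => h0.card_pos
    | succ k ih =>
      intro hk
      have h1 := ih (by omega)
      have h2 := Finset.card_lt_card ((hmono k).ssubset_of_ne (hne k (by omega)))
      omega
  have h1 := hcard m le_rfl
  have h2 := (I m).card_le_univ
  simp at h2
  omega

lemma logForm_apply (ξ : Fin m → EuclideanSpace ℂ (Fin n) →ᵃ[ℂ] ℂ) (α : Fin m → ℝ)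
    (z v : EuclideanSpace ℂ (Fin n)) :
    logForm ξ α z v = ∑ i, (α i : ℂ) / ξ i z * (ξ i).linear v := by
  simp [logForm]

/-- Near the union of the hyperplanes, the form `ω_α` takes values bounded from below on bounded
vectors. -/
lemma exists_lower_bound_logForm (ξ : Fin m → EuclideanSpace ℂ (Fin n) →ᵃ[ℂ] ℂ)
    {α : Fin m → ℝ} (hα : ∀ i, 0 < α i) (hm : 0 < m) :
    ∃ s₀ κ R : ℝ, 0 < s₀ ∧ 0 < κ ∧ 0 < R ∧ ∀ z ∈ complement ξ, (∃ i, ‖ξ i z‖ ≤ s₀) →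
      ∃ v, ‖v‖ ≤ R ∧ κ ≤ ‖logForm ξ α z v‖ := by
  have : Nonempty (Fin m) := ⟨⟨0, hm⟩⟩
  obtain ⟨C, δ, hC, hδ, hnear⟩ := exists_common_zero_near ξ
  set μ : ℝ := Finset.univ.inf' Finset.univ_nonempty α
  have hμ : 0 < μ := (Finset.lt_inf'_iff _).2 fun i _ => hα i
  let l : Fin m → EuclideanSpace ℂ (Fin n) →L[ℂ] ℂ :=
    fun i => LinearMap.toContinuousLinearMap (ξ i).linear
  set Λ : ℝ := ∑ i, α i * ‖l i‖
  have hΛ : 0 ≤ Λ := Finset.sum_nonneg fun i _ => mul_nonneg (hα i).le (norm_nonneg _)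
  -- The scale ratio `L` is chosen so that the large `ξ i` contribute at most `Λ * C / L ≤ μ / 2`.
  set L : ℝ := 2 * (Λ * C) / μ + 1 with hL
  have hL1 : 1 ≤ L := by rw [hL]; linarith [show 0 ≤ 2 * (Λ * C) / μ by positivity]
  have hL0 : 0 < L := by linarith
  have hLμ : Λ * C / L ≤ μ / 2 := by
    rw [div_le_iff₀ hL0, hL]
    have : μ / 2 * (2 * (Λ * C) / μ + 1) = Λ * C + μ / 2 := by field_simp
    linarith
  refine ⟨δ / (2 * L ^ m), μ / 2, C * δ, by positivity, by positivity, by positivity, ?_⟩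
  rintro z hz ⟨i₀, hi₀⟩
  set s₀ : ℝ := δ / (2 * L ^ m) with hs₀
  have hs₀pos : 0 < s₀ := by positivity
  -- If `I k = I (k + 1)`, no `‖ξ i z‖` lies in `]L ^ k * s₀, L ^ (k + 1) * s₀]`: a gap of ratio
  -- `L`. The value of `s₀` keeps all scales with `k ≤ m` below `δ`.
  let I : ℕ → Finset (Fin m) := fun k => Finset.univ.filter fun i => ‖ξ i z‖ ≤ L ^ k * s₀
  have hmemI : ∀ k i, i ∈ I k ↔ ‖ξ i z‖ ≤ L ^ k * s₀ := fun k i => by simp [I]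
  obtain ⟨k, hkm, hk⟩ := exists_stationary (I := I) ⟨i₀, by simpa [hmemI] using hi₀⟩
    (fun k i hi => by
      rw [hmemI] at hi ⊢
      refine hi.trans (mul_le_mul_of_nonneg_right ?_ hs₀pos.le)
      exact pow_le_pow_right₀ hL1 (Nat.le_succ k))
  have hi₀k : i₀ ∈ I k := by
    rw [hmemI]
    exact hi₀.trans (le_mul_of_one_le_left hs₀pos.le (one_le_pow₀ hL1))
  set s : ℝ := L ^ k * s₀ with hs
  have hspos : 0 < s := by positivity
  have hsδ : s < δ := by
    have h1 : L ^ k * s₀ ≤ L ^ m * s₀ :=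
      mul_le_mul_of_nonneg_right (pow_le_pow_right₀ hL1 hkm) hs₀pos.le
    have h2 : L ^ m * s₀ = δ / 2 := by rw [hs₀]; field_simp
    linarith
  obtain ⟨p, hp, hzp⟩ := hnear (I k) z s hspos.le hsδ fun i hi => (hmemI k i).1 hi
  refine ⟨z - p, hzp.trans (mul_le_mul_of_nonneg_left hsδ.le hC.le), ?_⟩
  have hlin : ∀ i, (ξ i).linear (z - p) = ξ i z - ξ i p := fun i => by
    simpa using (ξ i).linearMap_vsub z p
  -- For `i ∈ I k` the linear part at `z - p` equals `ξ i z`, so each term is exactly `α i`;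
  -- positivity excludes cancellation.
  have hin : ∑ i ∈ I k, (α i : ℂ) / ξ i z * (ξ i).linear (z - p) =
      ((∑ i ∈ I k, α i : ℝ) : ℂ) := by
    rw [Complex.ofReal_sum]
    refine Finset.sum_congr rfl fun i hi => ?_
    rw [hlin, hp i hi, sub_zero, div_mul_cancel₀ _ (hz i)]
  -- Outside `I k` the denominator exceeds `L * s`, whereas the numerator is of order `C * s`.
  have hout : ‖∑ i ∈ (I k)ᶜ, (α i : ℂ) / ξ i z * (ξ i).linear (z - p)‖ ≤ μ / 2 := by
    refine (norm_sum_le _ _).trans (le_trans ?_ hLμ)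
    have hterm : ∀ i ∈ (I k)ᶜ, ‖(α i : ℂ) / ξ i z * (ξ i).linear (z - p)‖ ≤
        α i * ‖l i‖ * C / L := by
      intro i hi
      have hbig : L * s < ‖ξ i z‖ := by
        rw [Finset.mem_compl, hk, hmemI, not_le] at hi
        rwa [hs, ← mul_assoc, ← pow_succ']
      have h1 : ‖(ξ i).linear (z - p)‖ ≤ ‖l i‖ * (C * s) :=
        ((l i).le_opNorm (z - p)).trans (mul_le_mul_of_nonneg_left hzp (norm_nonneg _))
      rw [norm_mul, norm_div, Complex.norm_real, Real.norm_eq_abs, abs_of_pos (hα i),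
        div_mul_eq_mul_div, div_le_div_iff₀ ((by positivity : 0 < L * s).trans hbig) hL0]
      calc α i * ‖(ξ i).linear (z - p)‖ * L ≤ α i * (‖l i‖ * (C * s)) * L := by
            gcongr; exact (hα i).le
        _ = α i * ‖l i‖ * C * (L * s) := by ring
        _ ≤ α i * ‖l i‖ * C * ‖ξ i z‖ := by
            refine mul_le_mul_of_nonneg_left hbig.le ?_
            have := (hα i).le
            positivity
    refine (Finset.sum_le_sum hterm).trans ?_
    rw [← Finset.sum_div, ← Finset.sum_mul]
    gcongr
    exact Finset.sum_le_sum_of_subset_of_nonneg (Finset.subset_univ _)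
      fun i _ _ => mul_nonneg (hα i).le (norm_nonneg _)
  have hsum : μ ≤ ∑ i ∈ I k, α i :=
    (Finset.inf'_le _ (Finset.mem_univ i₀)).trans
      (Finset.single_le_sum (fun i _ => (hα i).le) hi₀k)
  rw [logForm_apply, ← Finset.sum_add_sum_compl (I k), hin]
  have h1 := norm_sub_le_norm_add (((∑ i ∈ I k, α i : ℝ) : ℂ))
    (∑ i ∈ (I k)ᶜ, (α i : ℂ) / ξ i z * (ξ i).linear (z - p))
  rw [Complex.norm_real, Real.norm_eq_abs, abs_of_pos (hμ.trans_le hsum)] at h1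
  linarith

/-- For small values of `f_α`, the form `ω_α` takes the value `i` on a bounded vector. -/
lemma exists_bounded_vector (ξ : Fin m → EuclideanSpace ℂ (Fin n) →ᵃ[ℂ] ℂ)
    {α : Fin m → ℝ} (hα : ∀ i, 0 < α i) (hm : 0 < m) :
    ∃ ε₀ B : ℝ, 0 < ε₀ ∧ 0 < B ∧ ∀ z ∈ complement ξ, absValue ξ α z < ε₀ →
      ∃ v, ‖v‖ ≤ B ∧ logForm ξ α z v = Complex.I := by
  obtain ⟨s₀, κ, R, hs₀, hκ, hR, h⟩ := exists_lower_bound_logForm ξ hα hm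
  refine ⟨∏ i, s₀ ^ α i, R / κ, Finset.prod_pos fun i _ => Real.rpow_pos_of_pos hs₀ _,
    by positivity, fun z hz hzε => ?_⟩
  have hsmall : ∃ i, ‖ξ i z‖ ≤ s₀ := by
    by_contra! hbig
    refine absurd hzε (not_lt.2 (Finset.prod_le_prod (fun i _ => by positivity) fun i _ => ?_))
    exact Real.rpow_le_rpow hs₀.le (hbig i).le (hα i).le
  obtain ⟨v, hv, hκv⟩ := h z hz hsmall
  have hne : logForm ξ α z v ≠ 0 := norm_pos_iff.1 (hκ.trans_le hκv)
  -- Complex linearity allows the argument as well as the modulus of the value to be adjusted.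
  refine ⟨(Complex.I / logForm ξ α z v) • v, ?_, ?_⟩
  · rw [norm_smul, norm_div, Complex.norm_I, div_mul_eq_mul_div, one_mul]
    gcongr
  · rw [map_smul, smul_eq_mul, div_mul_cancel₀ _ hne]

end LowerBound

/-! ### Level sets of `f_α` -/

section Level

variable {n m : ℕ} {ξ : Fin m → EuclideanSpace ℂ (Fin n) →ᵃ[ℂ] ℂ} {α : Fin m → ℝ}

lemma continuous_affine (i : Fin m) : Continuous (ξ i) :=
  (ξ i).continuous_of_finiteDimensional

lemma continuous_absValue (hα : ∀ i, 0 < α i) : Continuous (absValue ξ α) :=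
  continuous_finsetProd _ fun i _ =>
    (continuous_affine i).norm.rpow_const fun _ => Or.inr (hα i).le

lemma mem_complement_of_absValue_ne_zero (hα : ∀ i, 0 < α i) {z : EuclideanSpace ℂ (Fin n)}
    (hz : absValue ξ α z ≠ 0) : z ∈ complement ξ := by
  intro i hi
  exact hz (Finset.prod_eq_zero (Finset.mem_univ i)
    (by rw [hi, norm_zero, Real.zero_rpow (hα i).ne']))

lemma absValue_pos {z : EuclideanSpace ℂ (Fin n)} (hz : z ∈ complement ξ) :
    0 < absValue ξ α z :=
  Finset.prod_pos fun i _ => Real.rpow_pos_of_pos (norm_pos_iff.2 (hz i)) _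

/-- Since the exponents are positive, `f_α` is continuous on the whole space and vanishes on the
hyperplanes, so a positive level does not accumulate there. -/
lemma isClosed_level (hα : ∀ i, 0 < α i) {ε : ℝ} (hε : 0 < ε) : IsClosed (level ξ α ε) := by
  have : level ξ α ε = absValue ξ α ⁻¹' {ε} := by
    ext z
    refine ⟨fun h => h.2, fun h => ⟨mem_complement_of_absValue_ne_zero hα ?_, h⟩⟩
    rw [mem_singleton_iff.1 h]
    exact hε.ne'
  rw [this]
  exact isClosed_singleton.preimage (continuous_absValue hα)

lemma isOpen_complement (ξ : Fin m → EuclideanSpace ℂ (Fin n) →ᵃ[ℂ] ℂ) :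
    IsOpen (complement ξ) := by
  simp only [complement, ofPred_forall]
  exact isOpen_iInter_of_finite fun i => isOpen_ne_fun (continuous_affine i) continuous_const

/-- On a real line through a zero of one `ξ i`, in a direction killed by no linear part, `f_α`
vanishes at that zero and is positive at some other point; the intermediate value theorem gives all
smaller levels. -/
lemma exists_level_nonempty (hξ : ∀ i, (ξ i).linear ≠ 0) (hα : ∀ i, 0 < α i) (hm : 0 < m) :
    ∃ ε₁ : ℝ, 0 < ε₁ ∧ ∀ ε, 0 < ε → ε < ε₁ → (level ξ α ε).Nonempty := by
  obtain ⟨v, hv⟩ := Module.Dual.exists_forall_ne_zero_of_forall_exists (fun i => (ξ i).linear)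
    fun i => by
      by_contra! h
      exact hξ i (LinearMap.ext h)
  let i₀ : Fin m := ⟨0, hm⟩
  let p : EuclideanSpace ℂ (Fin n) := -((ξ i₀ 0 / (ξ i₀).linear v) • v)
  have hdec : ∀ i z w, ξ i (z + w) = ξ i z + (ξ i).linear w := fun i z w => by
    have := (ξ i).map_vadd z w
    simp only [vadd_eq_add] at this
    rw [add_comm z w, this, add_comm]
  have hp : ξ i₀ p = 0 := by
    have := hdec i₀ 0 p
    rw [zero_add] at this
    rw [this, map_neg, map_smul, smul_eq_mul, div_mul_cancel₀ _ (hv i₀), add_neg_cancel]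
  let c : ℝ → EuclideanSpace ℂ (Fin n) := fun t => p + (t : ℂ) • v
  have hc : Continuous c := by fun_prop
  have hfin : {t : ℝ | ∃ i, ξ i (c t) = 0}.Finite := by
    have : {t : ℝ | ∃ i, ξ i (c t) = 0} = ⋃ i, {t : ℝ | ξ i (c t) = 0} := by
      ext t; simp
    rw [this]
    refine finite_iUnion fun i => Subsingleton.finite fun t ht t' ht' => ?_
    simp only [mem_ofPred_eq, c, hdec, map_smul, smul_eq_mul] at ht ht'
    have : ((t : ℂ) - t') * (ξ i).linear v = 0 := by linear_combination ht - ht'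
    rcases mul_eq_zero.1 this with h | h
    · exact_mod_cast sub_eq_zero.1 h
    · exact absurd h (hv i)
  obtain ⟨t₁, ht₁, hne⟩ := (Ioi_infinite (0 : ℝ)).exists_notMem_finite hfin
  have hcompl : c t₁ ∈ complement ξ := fun i hi => hne ⟨i, hi⟩
  refine ⟨absValue ξ α (c t₁), absValue_pos hcompl, fun ε hε hlt => ?_⟩
  have h0 : absValue ξ α (c 0) = 0 := Finset.prod_eq_zero (Finset.mem_univ i₀) (by
    simp [c, hp, Real.zero_rpow (hα i₀).ne'])
  obtain ⟨t, -, ht⟩ := intermediate_value_Icc (le_of_lt ht₁)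
    ((continuous_absValue (ξ := ξ) hα).comp hc).continuousOn
    (show ε ∈ Icc _ _ from ⟨by simpa [h0] using hε.le, hlt.le⟩)
  simp only [Function.comp_apply] at ht
  exact ⟨c t, mem_complement_of_absValue_ne_zero hα (by rw [ht]; exact hε.ne'), ht⟩

end Level

/-! ### Local branches of the logarithm -/

section LocalLogarithm

variable {n m : ℕ} {ξ : Fin m → EuclideanSpace ℂ (Fin n) →ᵃ[ℂ] ℂ} {α : Fin m → ℝ}

/-- The branch of `∑ α_i log ξ_i` near `x` which vanishes at `x`. -/
def localLog (ξ : Fin m → EuclideanSpace ℂ (Fin n) →ᵃ[ℂ] ℂ) (α : Fin m → ℝ)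
    (x z : EuclideanSpace ℂ (Fin n)) : ℂ :=
  ∑ i, (α i : ℂ) * Complex.log (ξ i z / ξ i x)

/-- A neighbourhood of `x` on which `localLog ξ α x` is holomorphic. -/
def logDomain (ξ : Fin m → EuclideanSpace ℂ (Fin n) →ᵃ[ℂ] ℂ) (x : EuclideanSpace ℂ (Fin n)) :
    Set (EuclideanSpace ℂ (Fin n)) :=
  {z | ∀ i, ξ i z / ξ i x ∈ Complex.slitPlane}

lemma isOpen_logDomain (x : EuclideanSpace ℂ (Fin n)) : IsOpen (logDomain ξ x) := by
  simp only [logDomain, ofPred_forall]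
  exact isOpen_iInter_of_finite fun i =>
    Complex.isOpen_slitPlane.preimage ((continuous_affine i).div_const _)

lemma mem_logDomain {x : EuclideanSpace ℂ (Fin n)} (hx : x ∈ complement ξ) :
    x ∈ logDomain ξ x := fun i => by
  rw [div_self (hx i)]
  exact Complex.one_mem_slitPlane

lemma logDomain_subset {x : EuclideanSpace ℂ (Fin n)} : logDomain ξ x ⊆ complement ξ := by
  intro z hz i hi
  have := hz i
  rw [hi, zero_div] at this
  exact Complex.zero_notMem_slitPlane this

lemma localLog_self {x : EuclideanSpace ℂ (Fin n)} (hx : x ∈ complement ξ) :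
    localLog ξ α x x = 0 :=
  Finset.sum_eq_zero fun i _ => by rw [div_self (hx i), Complex.log_one, mul_zero]

lemma coe_affine_eq (i : Fin m) : (ξ i : EuclideanSpace ℂ (Fin n) → ℂ) =
    fun z => LinearMap.toContinuousLinearMap (ξ i).linear z + ξ i 0 := by
  ext z
  have := (ξ i).linearMap_vsub z 0
  simp only [vsub_eq_sub, sub_zero] at this
  simp [this]

lemma hasFDerivAt_affine (i : Fin m) (z : EuclideanSpace ℂ (Fin n)) :
    HasFDerivAt (ξ i) (LinearMap.toContinuousLinearMap (ξ i).linear) z := by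
  rw [coe_affine_eq]
  exact (ContinuousLinearMap.hasFDerivAt _).add_const _

lemma contDiff_affine (i : Fin m) : ContDiff ℂ ∞ (ξ i) := by
  rw [coe_affine_eq]
  exact (ContinuousLinearMap.contDiff _).add contDiff_const

lemma hasFDerivAt_localLog {x z : EuclideanSpace ℂ (Fin n)} (hx : x ∈ complement ξ)
    (hz : z ∈ logDomain ξ x) :
    HasFDerivAt (localLog ξ α x) ((logForm ξ α z).restrictScalars ℝ) z := by
  refine HasFDerivAt.restrictScalars ℝ ?_
  refine HasFDerivAt.fun_sum fun i _ => ?_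
  have h1 : HasFDerivAt (fun z => ξ i z / ξ i x)
      ((ξ i x)⁻¹ • LinearMap.toContinuousLinearMap (ξ i).linear) z := by
    simpa only [div_eq_mul_inv] using (hasFDerivAt_affine i z).mul_const (ξ i x)⁻¹
  have h2 := (h1.clog (hz i)).const_mul (α i : ℂ)
  convert! h2 using 1
  rw [smul_smul, smul_smul]
  congr 1
  have := hx i
  have := logDomain_subset hz i
  field_simp

lemma contDiffOn_localLog (x : EuclideanSpace ℂ (Fin n)) :
    ContDiffOn ℝ ∞ (localLog ξ α x) (logDomain ξ x) := by
  refine ContDiffOn.restrict_scalars (𝕜' := ℂ) ℝ ?_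
  refine ContDiffOn.sum fun i _ => contDiffOn_const.mul ?_
  exact fun z hz => (ContDiffAt.comp z (f := fun z => ξ i z / ξ i x)
    (Complex.contDiffAt_log (hz i))
    ((contDiff_affine i).div_const (ξ i x)).contDiffAt).contDiffWithinAt

lemma log_absValue {z : EuclideanSpace ℂ (Fin n)} (hz : z ∈ complement ξ) :
    Real.log (absValue ξ α z) = ∑ i, α i * Real.log ‖ξ i z‖ := by
  rw [absValue, Real.log_prod fun i _ => (Real.rpow_pos_of_pos (norm_pos_iff.2 (hz i)) _).ne']
  exact Finset.sum_congr rfl fun i _ => Real.log_rpow (norm_pos_iff.2 (hz i)) _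

/-- The real part of the logarithm has no branch ambiguity, so the formula holds on the whole
complement and not only on `logDomain ξ x`. -/
lemma re_localLog {x z : EuclideanSpace ℂ (Fin n)} (hx : x ∈ complement ξ)
    (hz : z ∈ complement ξ) :
    (localLog ξ α x z).re = Real.log (absValue ξ α z) - Real.log (absValue ξ α x) := by
  rw [log_absValue hx, log_absValue hz, localLog, Complex.re_sum, ← Finset.sum_sub_distrib]
  refine Finset.sum_congr rfl fun i _ => ?_
  rw [Complex.re_ofReal_mul, Complex.log_re, norm_div,
    Real.log_div (norm_ne_zero_iff.2 (hz i)) (norm_ne_zero_iff.2 (hx i)), mul_sub]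

lemma im_localLog (x z : EuclideanSpace ℂ (Fin n)) :
    (localLog ξ α x z).im = ∑ i, α i * (ξ i z / ξ i x).arg := by
  rw [localLog, Complex.im_sum]
  exact Finset.sum_congr rfl fun i _ => by rw [Complex.im_ofReal_mul, Complex.log_im]

lemma hasFDerivAt_log_absValue {z : EuclideanSpace ℂ (Fin n)} (hz : z ∈ complement ξ) :
    HasFDerivAt (fun z => Real.log (absValue ξ α z))
      (Complex.reCLM.comp ((logForm ξ α z).restrictScalars ℝ)) z := by
  have h1 := (Complex.reCLM.hasFDerivAt.comp z
    (hasFDerivAt_localLog (α := α) hz (mem_logDomain hz))).add_const (Real.log (absValue ξ α z))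
  refine h1.congr_of_eventuallyEq ?_
  filter_upwards [(isOpen_complement ξ).mem_nhds hz] with y hy
  simp [re_localLog hz hy]

lemma hasFDerivAt_im_localLog {x z : EuclideanSpace ℂ (Fin n)} (hx : x ∈ complement ξ)
    (hz : z ∈ logDomain ξ x) :
    HasFDerivAt (fun z => (localLog ξ α x z).im) (imLogForm ξ α z) z :=
  Complex.imCLM.hasFDerivAt.comp z (hasFDerivAt_localLog hx hz)

lemma mem_level_iff {x y : EuclideanSpace ℂ (Fin n)} {ε : ℝ} (hx : x ∈ level ξ α ε)
    (hy : y ∈ complement ξ) : y ∈ level ξ α ε ↔ (localLog ξ α x y).re = 0 := by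
  rw [re_localLog hx.1 hy, sub_eq_zero, hx.2]
  have hε : 0 < ε := hx.2 ▸ absValue_pos hx.1
  exact ⟨fun h => by rw [h.2], fun h => ⟨hy, Real.log_injOn_pos (absValue_pos hy) hε h⟩⟩

end LocalLogarithm

/-! ### The dual field and its flow -/

section DualField

variable {n m : ℕ} {ξ : Fin m → EuclideanSpace ℂ (Fin n) →ᵃ[ℂ] ℂ} {α : Fin m → ℝ}

lemma inner_dualField (z v : EuclideanSpace ℂ (Fin n)) :
    inner ℝ (dualField ξ α z) v = (logForm ξ α z v).im := by
  rw [dualField, InnerProductSpace.toDual_symm_apply]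
  rfl

lemma real_inner_I_smul (v : EuclideanSpace ℂ (Fin n)) : inner ℝ v (Complex.I • v) = 0 := by
  simp [PiLp.inner_apply, Complex.inner, mul_comm]

/-- By complex linearity `Re ω(v) = Im ω(i v) = ⟪ι, i v⟫`, which vanishes for `v = ι`. -/
lemma logForm_dualField (z : EuclideanSpace ℂ (Fin n)) :
    logForm ξ α z (dualField ξ α z) = (‖dualField ξ α z‖ ^ 2 : ℝ) * Complex.I := by
  have h1 : (logForm ξ α z (dualField ξ α z)).im = ‖dualField ξ α z‖ ^ 2 := by
    rw [← inner_dualField, real_inner_self_eq_norm_sq]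
  have h2 : (logForm ξ α z (dualField ξ α z)).re = 0 := by
    have h3 := inner_dualField (ξ := ξ) (α := α) z (Complex.I • dualField ξ α z)
    rw [real_inner_I_smul, map_smul, smul_eq_mul, Complex.I_mul_im] at h3
    exact h3.symm
  apply Complex.ext <;> simp [h1, h2, -Complex.ofReal_pow]

lemma logForm_normalizedDualField {z : EuclideanSpace ℂ (Fin n)} (hz : dualField ξ α z ≠ 0) :
    logForm ξ α z (normalizedDualField ξ α z) = Complex.I := by
  have h : (‖dualField ξ α z‖ : ℂ) ≠ 0 := by exact_mod_cast norm_ne_zero_iff.2 hz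
  rw [normalizedDualField, ← Complex.coe_smul, map_smul, logForm_dualField, smul_eq_mul]
  push_cast
  field_simp

/-- Cauchy–Schwarz gives `1 = ⟪ι, v⟫ ≤ ‖ι‖ ‖v‖`, and the normalized field has norm `1 / ‖ι‖`. -/
lemma norm_normalizedDualField_le {z v : EuclideanSpace ℂ (Fin n)} {B : ℝ} (hv : ‖v‖ ≤ B)
    (hω : logForm ξ α z v = Complex.I) :
    dualField ξ α z ≠ 0 ∧ ‖normalizedDualField ξ α z‖ ≤ B := by
  have h1 : 1 ≤ ‖dualField ξ α z‖ * ‖v‖ := by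
    have := real_inner_le_norm (dualField ξ α z) v
    rwa [inner_dualField, hω, Complex.I_im] at this
  have hne : dualField ξ α z ≠ 0 := by
    intro h
    rw [h, norm_zero, zero_mul] at h1
    linarith
  have hpos := norm_pos_iff.2 hne
  refine ⟨hne, ?_⟩
  rw [normalizedDualField, norm_smul, norm_inv, norm_pow, norm_norm, inv_mul_eq_div,
    div_le_iff₀ (by positivity)]
  nlinarith

/-- The inverse of the Riesz isomorphism of a real Hilbert space as a linear map. -/
def rieszInverse (V : Type*) [NormedAddCommGroup V] [InnerProductSpace ℝ V] [CompleteSpace V] :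
    (V →L[ℝ] ℝ) →L[ℝ] V :=
  { toFun := (InnerProductSpace.toDual ℝ V).symm
    map_add' := map_add _
    map_smul' := fun c f => by simp
    cont := (InnerProductSpace.toDual ℝ V).symm.continuous }

lemma contDiffOn_dualField : ContDiffOn ℝ ∞ (dualField ξ α) (complement ξ) := by
  have h1 : ContDiffOn ℝ ∞ (logForm ξ α) (complement ξ) := by
    refine ContDiffOn.restrict_scalars (𝕜' := ℂ) ℝ ?_
    refine ContDiffOn.sum fun i _ => ContDiffOn.fun_smul ?_ contDiffOn_const
    exact contDiffOn_const.div (contDiff_affine i).contDiffOn fun z hz => hz i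
  have h2 : ContDiff ℝ ∞ (fun f : EuclideanSpace ℂ (Fin n) →L[ℂ] ℂ =>
      rieszInverse (EuclideanSpace ℂ (Fin n)) (Complex.imCLM.comp (f.restrictScalars ℝ))) :=
    (rieszInverse _).contDiff.comp ((ContinuousLinearMap.compL ℝ _ _ _ Complex.imCLM).contDiff.comp
      (ContinuousLinearMap.restrictScalarsL ℂ (EuclideanSpace ℂ (Fin n)) ℂ ℝ ℝ).contDiff)
  exact h2.comp_contDiffOn h1

/-- The open set on which the dual field does not vanish. -/
def regularSet (ξ : Fin m → EuclideanSpace ℂ (Fin n) →ᵃ[ℂ] ℂ) (α : Fin m → ℝ) :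
    Set (EuclideanSpace ℂ (Fin n)) :=
  complement ξ ∩ dualField ξ α ⁻¹' {0}ᶜ

lemma isOpen_regularSet : IsOpen (regularSet ξ α) :=
  contDiffOn_dualField.continuousOn.isOpen_inter_preimage (isOpen_complement ξ)
    isOpen_compl_singleton

lemma contDiffOn_normalizedDualField :
    ContDiffOn ℝ ∞ (normalizedDualField ξ α) (regularSet ξ α) := by
  have h := (contDiffOn_dualField (ξ := ξ) (α := α)).mono
    (inter_subset_left : regularSet ξ α ⊆ complement ξ)
  exact ((h.norm_sq ℝ).inv fun z hz => pow_ne_zero 2 (norm_ne_zero_iff.2 hz.2)).smul h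

lemma surjective_logForm {z : EuclideanSpace ℂ (Fin n)} (hz : dualField ξ α z ≠ 0) :
    Function.Surjective ((logForm ξ α z).restrictScalars ℝ) := by
  intro w
  refine ⟨(w / Complex.I) • normalizedDualField ξ α z, ?_⟩
  rw [ContinuousLinearMap.coe_restrictScalars', map_smul, logForm_normalizedDualField hz,
    smul_eq_mul, div_mul_cancel₀ _ Complex.I_ne_zero]

/-- The defining function is `log f_α - log ε`, with differential `Re ω_α`; tangency is `Re i = 0`.
-/
lemma exists_isCompleteFlow_level (hα : ∀ i, 0 < α i) {ε B : ℝ} (hε : 0 < ε)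
    (hι : ∀ z ∈ level ξ α ε, dualField ξ α z ≠ 0)
    (hB : ∀ z ∈ level ξ α ε, ‖normalizedDualField ξ α z‖ ≤ B) :
    ∃ Φ : EuclideanSpace ℂ (Fin n) → ℝ → EuclideanSpace ℂ (Fin n),
      IsCompleteFlow (normalizedDualField ξ α) (level ξ α ε) Φ ∧
        ∀ x ∈ level ξ α ε, ∀ s t, Φ (Φ x s) t = Φ x (s + t) := by
  have : FiniteDimensional ℝ (EuclideanSpace ℂ (Fin n)) := FiniteDimensional.complexToReal _
  refine exists_isCompleteFlow (isClosed_level hα hε) (isOpen_regularSet (ξ := ξ) (α := α))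
    (fun z hz => ⟨hz.1, hι z hz⟩) contDiffOn_normalizedDualField hB
    (ℓ := fun z => Real.log (absValue ξ α z) - Real.log ε)
    (fun z hz => (hasFDerivAt_log_absValue hz.1).sub_const _) (fun z hz => ?_) (fun z hz => ?_)
  · rw [sub_eq_zero]
    exact ⟨fun h => by rw [h.2], fun h => ⟨hz.1, Real.log_injOn_pos (absValue_pos hz.1) hε h⟩⟩
  · simp [logForm_normalizedDualField hz.2]

end DualField

/-! ### The level set and the fibres as submanifolds -/

section Submanifolds

variable {n m : ℕ} {ξ : Fin m → EuclideanSpace ℂ (Fin n) →ᵃ[ℂ] ℂ} {α : Fin m → ℝ} {ε : ℝ}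

lemma finrank_real_euclideanSpace_complex (n : ℕ) :
    Module.finrank ℝ (EuclideanSpace ℂ (Fin n)) = 2 * n := by
  rw [finrank_real_of_complex, finrank_euclideanSpace_fin]

lemma isEmbeddedSubmanifold_level (hn : 0 < n)
    (hι : ∀ z ∈ level ξ α ε, dualField ξ α z ≠ 0) :
    IsEmbeddedSubmanifold (2 * n - 1) (level ξ α ε) := by
  have : FiniteDimensional ℝ (EuclideanSpace ℂ (Fin n)) := FiniteDimensional.complexToReal _
  refine isEmbeddedSubmanifold_of_submersion (G := ℝ)
    (by rw [finrank_real_euclideanSpace_complex, Module.finrank_self]; omega) fun x hx =>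
    ⟨fun z => (localLog ξ α x z).re, logDomain ξ x, isOpen_logDomain x, mem_logDomain hx.1,
      Complex.reCLM.contDiff.comp_contDiffOn (contDiffOn_localLog x), ?_,
      fun y hy => mem_level_iff hx (logDomain_subset hy)⟩
  have h1 : HasFDerivAt (fun z => (localLog ξ α x z).re)
      (Complex.reCLM.comp ((logForm ξ α x).restrictScalars ℝ)) x :=
    Complex.reCLM.hasFDerivAt.comp x (hasFDerivAt_localLog hx.1 (mem_logDomain hx.1))
  rw [h1.fderiv]
  exact Function.Surjective.comp (g := Complex.re) (fun r => ⟨r, Complex.ofReal_re r⟩)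
    (surjective_logForm (hι x hx))

lemma coe_eq_zero_of_abs_lt {a t : ℝ} (ht : |t| < a) (h : (t : AddCircle a) = 0) : t = 0 := by
  obtain ⟨k, hk⟩ := (AddCircle.coe_eq_zero_iff a).1 h
  have ha : 0 < a := (abs_nonneg t).trans_lt ht
  rw [← hk, zsmul_eq_mul, abs_mul, abs_of_pos ha] at ht
  have h1 : |(k : ℝ)| < 1 := by nlinarith
  have h2 : k = 0 := by
    rw [← Int.cast_abs] at h1
    exact Int.abs_lt_one_iff.1 (by exact_mod_cast h1)
  rw [← hk, h2, zero_smul]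

/-- Near `x` the fibre is the zero set of the complex submersion `localLog ξ α x`: its real part
cuts out `V`, and its imaginary part lifts `g - c`. -/
lemma isEmbeddedSubmanifold_fibre (hn : 0 < n)
    (hι : ∀ z ∈ level ξ α ε, dualField ξ α z ≠ 0) {a : ℝ} (ha : 0 < a)
    {g : level ξ α ε → AddCircle a} (hg : HasDifferential g (imLogForm ξ α)) (c : AddCircle a) :
    IsEmbeddedSubmanifold (2 * n - 2) (preimageIn g {c}) := by
  have : FiniteDimensional ℝ (EuclideanSpace ℂ (Fin n)) := FiniteDimensional.complexToReal _
  refine isEmbeddedSubmanifold_of_submersion (G := ℂ)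
    (by rw [finrank_real_euclideanSpace_complex, Complex.finrank_real_complex]; omega)
    fun x hx => ?_
  obtain ⟨hxS, hgx⟩ := mem_preimageIn.1 hx
  rw [mem_singleton_iff] at hgx
  obtain ⟨W, h, hW, hxW, -, hd⟩ := hg x hxS
  have hxL := mem_logDomain hxS.1
  -- The lift of `g` and the imaginary part of the local logarithm have the same differential along
  -- `V`, hence differ by a constant near `x`.
  have hconst := (isEmbeddedSubmanifold_level hn hι).eventually_eq_of_hasFDerivWithinAt_zero
    (hW.inter (isOpen_logDomain (ξ := ξ) x)) hxS ⟨hxW, hxL⟩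
    (k := fun y => h y - (localLog ξ α x y).im) fun y hyS hy => by
      simpa using (hd y hyS hy.1).2.fun_sub
        (hasFDerivAt_im_localLog (α := α) hxS.1 hy.2).hasFDerivWithinAt
  simp only [localLog_self hxS.1, Complex.zero_im, sub_zero] at hconst
  -- Where the imaginary part is smaller than `a`, being zero modulo `a` means being zero.
  have hsmall : ∀ᶠ y in 𝓝 x, |(localLog ξ α x y).im| < a := by
    have hcont : ContinuousAt (fun y => |(localLog ξ α x y).im|) x :=
      (hasFDerivAt_im_localLog hxS.1 hxL).continuousAt.abs
    exact hcont.eventually (Iio_mem_nhds (by simpa [localLog_self hxS.1] using ha))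
  obtain ⟨U, hUs, hU, hxU⟩ := mem_nhds_iff.1
    (Filter.Eventually.and (eventually_nhdsWithin_iff.1 hconst) hsmall)
  refine ⟨localLog ξ α x, U ∩ (W ∩ logDomain ξ x), hU.inter (hW.inter (isOpen_logDomain x)),
    ⟨hxU, hxW, hxL⟩, (contDiffOn_localLog x).mono fun y hy => hy.2.2, ?_, ?_⟩
  · rw [(hasFDerivAt_localLog hxS.1 hxL).fderiv]
    exact surjective_logForm (hι x hxS)
  · rintro y ⟨hyU, hyW, hyL⟩
    have hlev := mem_level_iff hxS (logDomain_subset hyL)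
    have key : ∀ hyS : y ∈ level ξ α ε,
        g ⟨y, hyS⟩ = c + ((localLog ξ α x y).im : AddCircle a) := fun hyS => by
      rw [← hgx, ← (hd y hyS hyW).1, ← (hd x hxS hxW).1, ← AddCircle.coe_add,
        ← (hUs hyU).1 hyS, sub_add_cancel]
    rw [mem_preimageIn]
    constructor
    · rintro ⟨hyS, hgy⟩
      rw [key hyS, mem_singleton_iff, add_eq_left] at hgy
      exact Complex.ext (hlev.1 hyS) (coe_eq_zero_of_abs_lt (hUs hyU).2 hgy)
    · intro h0
      have hyS := hlev.2 (by rw [h0, Complex.zero_re])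
      refine ⟨hyS, ?_⟩
      rw [key hyS, h0, Complex.zero_im, AddCircle.coe_zero, add_zero, mem_singleton_iff]

end Submanifolds

/-! ### The circle-valued argument in rank one -/

section Argument

variable {n m : ℕ} {ξ : Fin m → EuclideanSpace ℂ (Fin n) →ᵃ[ℂ] ℂ} {α : Fin m → ℝ} {ε : ℝ}

/-- The components of a vector of rank one are integer multiples of a common real number. -/
lemma exists_eq_intCast_mul (hrank : vectorRank α = 1) :
    ∃ c : ℝ, 0 < c ∧ ∃ N : Fin m → ℤ, ∀ i, α i = N i * c := by
  obtain ⟨w, hw0, hw⟩ := finrank_eq_one_iff'.1 hrank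
  have hq : ∀ i, ∃ q : ℚ, α i = q * (w : ℝ) := fun i => by
    obtain ⟨q, hq⟩ := hw ⟨α i, Submodule.subset_span ⟨i, rfl⟩⟩
    refine ⟨q, ?_⟩
    have := congrArg Subtype.val hq
    simpa [Rat.smul_def] using this.symm
  choose q hq using hq
  have hw0' : (w : ℝ) ≠ 0 := by simpa using hw0
  set D : ℕ := ∏ i, (q i).den
  have hD : 0 < D := Finset.prod_pos fun i _ => (q i).den_pos
  have hN : ∀ i, ∃ N : ℤ, (q i : ℝ) * D = N := fun i => by
    obtain ⟨e, he⟩ : (q i).den ∣ D := Finset.dvd_prod_of_mem _ (Finset.mem_univ i)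
    refine ⟨(q i).num * e, ?_⟩
    have h1 : ((q i : ℚ) : ℝ) * ((q i).den : ℝ) = ((q i).num : ℝ) := by
      exact_mod_cast Rat.mul_den_eq_num (q i)
    rw [he]
    push_cast
    rw [← mul_assoc, h1]
  choose N hN using hN
  have hD' : (D : ℝ) ≠ 0 := by exact_mod_cast hD.ne'
  have hαN : ∀ i, α i = N i * ((w : ℝ) / D) := fun i => by
    rw [hq i, ← hN i]
    field_simp
  -- The generator may be negative; its sign is then absorbed into the integers.
  rcases lt_or_gt_of_ne (div_ne_zero hw0' hD') with h | h
  · refine ⟨-((w : ℝ) / D), by linarith, fun i => -N i, fun i => ?_⟩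
    rw [hαN i]
    push_cast
    ring
  · exact ⟨(w : ℝ) / D, h, N, hαN⟩

/-- The argument is additive only modulo `2π`; the integer `k` records the defect. -/
lemma exists_arg_sub_eq {x z : ℂ} (hx : x ≠ 0) (hz : z ≠ 0) :
    ∃ k : ℤ, x.arg + (z / x).arg - z.arg = 2 * Real.pi * k := by
  rw [← Real.Angle.angle_eq_iff_two_pi_dvd_sub, Real.Angle.coe_add,
    ← Complex.arg_mul_coe_angle hx (div_ne_zero hz hx), mul_div_cancel₀ _ hx]

/-- If `α` has rank one, the argument of the multivalued function `∏ ξ_i ^ α_i` defines a map to a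
circle with differential `Im ω_α`. -/
lemma exists_hasDifferential (hrank : vectorRank α = 1) :
    ∃ a : ℝ, 0 < a ∧ ∃ g : level ξ α ε → AddCircle a, HasDifferential g (imLogForm ξ α) := by
  obtain ⟨c, hc, N, hN⟩ := exists_eq_intCast_mul hrank
  -- Changing the argument of `ξ i` by `2π k` changes the sum by `2π k α_i = (N i * k) * a`, which
  -- is trivial in the circle.
  refine ⟨2 * Real.pi * c, by positivity,
    fun z => ((∑ i, α i * (ξ i (z : EuclideanSpace ℂ (Fin n))).arg : ℝ) : AddCircle _),
    fun x hx => ⟨logDomain ξ x,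
      fun z => (∑ i, α i * (ξ i x).arg) + (localLog ξ α x z).im, isOpen_logDomain x,
      mem_logDomain hx.1, ?_, fun y hy hyL => ⟨?_, ?_⟩⟩⟩
  · exact contDiffOn_const.add ((Complex.imCLM.contDiff.comp_contDiffOn
      (contDiffOn_localLog x)).mono inter_subset_right)
  · choose k hk using fun i => exists_arg_sub_eq (hx.1 i) (hy.1 i)
    rw [← sub_eq_zero, ← AddCircle.coe_sub, AddCircle.coe_eq_zero_iff]
    refine ⟨∑ i, N i * k i, ?_⟩
    simp only
    rw [im_localLog, ← Finset.sum_add_distrib, ← Finset.sum_sub_distrib, zsmul_eq_mul,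
      Int.cast_sum, Finset.sum_mul]
    refine Finset.sum_congr rfl fun i _ => ?_
    rw [← mul_add, ← mul_sub, hk i, hN i]
    push_cast
    ring
  · exact ((hasFDerivAt_im_localLog hx.1 hyL).const_add _).hasFDerivWithinAt

end Argument

end Arrangement

end
-- The theorem
theorem proposition5p2 (n m : ℕ) (ξ : Fin m → EuclideanSpace ℂ (Fin n) →ᵃ[ℂ] ℂ)
    (hξ : ∀ i, (ξ i).linear ≠ 0) (α : Fin m → ℝ) (hα : ∀ i, 0 < α i)
    (hrank : Arrangement.vectorRank α = 1) :
    ∃ ε₀ : ℝ, 0 < ε₀ ∧ ∀ ε : ℝ, 0 < ε → ε < ε₀ →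
      (Arrangement.level ξ α ε).Nonempty ∧
      Arrangement.IsEmbeddedSubmanifold (2 * n - 1) (Arrangement.level ξ α ε) ∧
      (∀ z ∈ Arrangement.level ξ α ε, Arrangement.dualField ξ α z ≠ 0) ∧
      (∃ a : ℝ, 0 < a ∧ ∃ g : Arrangement.level ξ α ε → AddCircle a,
        Arrangement.HasDifferential g (Arrangement.imLogForm ξ α)) ∧
      ∃ Φ : EuclideanSpace ℂ (Fin n) → ℝ → EuclideanSpace ℂ (Fin n),
        Arrangement.IsCompleteFlow (Arrangement.normalizedDualField ξ α)
          (Arrangement.level ξ α ε) Φ ∧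
        ∀ a : ℝ, 0 < a → ∀ g : Arrangement.level ξ α ε → AddCircle a,
          Arrangement.HasDifferential g (Arrangement.imLogForm ξ α) →
          Arrangement.IsLocallyTrivialSmoothFibration (2 * n - 2) g ∧
          (∀ (x : EuclideanSpace ℂ (Fin n)) (hx : x ∈ Arrangement.level ξ α ε) (t : ℝ),
            ∃ h : Φ x t ∈ Arrangement.level ξ α ε,
              g ⟨Φ x t, h⟩ = g ⟨x, hx⟩ + (t : AddCircle a)) ∧
          ∀ b : ℝ, Arrangement.IsDiffeoOn
            (fun p : EuclideanSpace ℂ (Fin n) × ℝ => Φ p.1 p.2)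
            (Arrangement.preimageIn g {(b : AddCircle a)} ×ˢ Set.Ioo (-(a / 2)) (a / 2))
            (Arrangement.preimageIn g ({((b + a / 2 : ℝ) : AddCircle a)}ᶜ : Set (AddCircle a))) := by
  have hm : 0 < m := by
    rcases Nat.eq_zero_or_pos m with rfl | hm
    · rw [Arrangement.vectorRank, Set.range_eq_empty, Submodule.span_empty, finrank_bot] at hrank
      exact absurd hrank zero_ne_one
    · exact hm
  -- On a point there are no non-constant affine functions; `0 < n` also ensures that `2 * n - 1`
  -- and `2 * n - 2` are not truncated.
  have hn : 0 < n := by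
    rcases Nat.eq_zero_or_pos n with rfl | hn
    · exact absurd (LinearMap.ext fun v => by rw [Subsingleton.elim v 0, map_zero, map_zero])
        (hξ ⟨0, hm⟩)
    · exact hn
  obtain ⟨ε₀, B, hε₀, -, hbound⟩ := Arrangement.exists_bounded_vector ξ hα hm
  obtain ⟨ε₁, hε₁, hne⟩ := Arrangement.exists_level_nonempty hξ hα hm
  refine ⟨min ε₀ ε₁, lt_min hε₀ hε₁, fun ε hε hlt => ?_⟩
  have hfield : ∀ z ∈ Arrangement.level ξ α ε, Arrangement.dualField ξ α z ≠ 0 ∧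
      ‖Arrangement.normalizedDualField ξ α z‖ ≤ B := fun z hz => by
    obtain ⟨v, hv, hω⟩ := hbound z hz.1 (hz.2.trans_lt (hlt.trans_le (min_le_left _ _)))
    exact Arrangement.norm_normalizedDualField_le hv hω
  have hι := fun z hz => (hfield z hz).1
  have hnonempty := hne ε hε (hlt.trans_le (min_le_right _ _))
  obtain ⟨Φ, hΦ, hadd⟩ :=
    Arrangement.exists_isCompleteFlow_level hα hε hι fun z hz => (hfield z hz).2
  have hη : ∀ x ∈ Arrangement.level ξ α ε,
      Arrangement.imLogForm ξ α x (Arrangement.normalizedDualField ξ α x) = 1 := fun x hx =>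
    (congrArg Complex.im (Arrangement.logForm_normalizedDualField (hι x hx))).trans Complex.I_im
  exact ⟨hnonempty, Arrangement.isEmbeddedSubmanifold_level hn hι, hι,
    Arrangement.exists_hasDifferential hrank, Φ, hΦ, fun a ha g hg =>
    ⟨hg.isLocallyTrivialSmoothFibration ha hnonempty hΦ hη hadd
      (Arrangement.isEmbeddedSubmanifold_fibre hn hι ha hg),
      fun x hx t => ⟨hΦ.mem x hx t, hg.apply_flow hΦ hη hx t⟩,
      hg.isDiffeoOn_flow ha hΦ hη hadd⟩⟩
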